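/- Let $p$ be a prime, $a\ge 1$, $q=p^a$, and let $k$ be an algebraically closed field of characteristic $p$. Let $S\subset\mathbf P^3_k$ be the surface $x_0x_1^q-x_1x_0^q+x_2x_3^q-x_3x_2^q=0$, and let $\ell$ be any line contained in $S$ (for instance a line defined over $\mathbf F_{q^2}$). Let $\mathbf P^1$ denote the set of planes through $\ell$, and let $f\colon S\to\mathbf P^1$ be the map of the pencil of planes through $\ell$: a point $P\notin\ell$ is sent to the plane spanned by $\ell$ and $P$, and a point $P\in\ell$ to the tangent plane of $S$ at $P$. For a plane $H\supset\ell$ let the fiber $C_H$ be the residual curve of $\ell$ in $S\cap H$, so that $S\cap H=\ell+C_H$. Call $C_H$ a singular (degenerate) fiber if it is not an integral curve. Then: 1. $f$ is well defined, and for every plane $H\supset\ell$ the set of points of $C_H$ is $f^{-1}(H)$. 2. There are exactly $q^2+1$ singular fibers. 3. Every other fiber is an integral rational curve. If $q>2$, it has exactly one singular point; if $q=2$, it has no singular point. 4. Each singular fiber is, as a scheme, the reduced union of $q$ distinct lines on $S$ which all pass through one common point $P$; any two of them meet only at $P$, and they meet there transversely on $S$. -/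

import Mathlib

open scoped LinearAlgebra.Projectivization

noncomputable section

namespace HermitianPencil

variable {k : Type*} [Field k]

/-- The form `x₀ x₁^q - x₁ x₀^q + x₂ x₃^q - x₃ x₂^q`, whose zero locus in `ℙ³` is the surface `S`. -/
def surfaceForm (k : Type*) [Field k] (q : ℕ) : MvPolynomial (Fin 4) k :=
  MvPolynomial.X 0 * MvPolynomial.X 1 ^ q - MvPolynomial.X 1 * MvPolynomial.X 0 ^ q
    + MvPolynomial.X 2 * MvPolynomial.X 3 ^ q - MvPolynomial.X 3 * MvPolynomial.X 2 ^ q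

/-- The homogeneous ideal of the surface `S` in `ℙ³`. -/
def surfaceIdeal (k : Type*) [Field k] (q : ℕ) : Ideal (MvPolynomial (Fin 4) k) :=
  Ideal.span {surfaceForm k q}

/-- The homogeneous ideal of the linear subvariety `ℙ(W)` of `ℙ³`. -/
def linearIdeal (W : Submodule k (Fin 4 → k)) : Ideal (MvPolynomial (Fin 4) k) :=
  MvPolynomial.vanishingIdeal k (W : Set (Fin 4 → k))

/-- The point `P` of `ℙ³` lies on the closed subscheme with homogeneous ideal `I`. -/
def OnScheme (I : Ideal (MvPolynomial (Fin 4) k)) (P : ℙ k (Fin 4 → k)) : Prop :=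
  ∀ g ∈ I, MvPolynomial.eval P.rep g = 0

/-- The embedded Zariski tangent space at `P` of the closed subscheme of `ℙ³` with homogeneous
ideal `I`, as a linear subspace of `k⁴` (its dimension is one more than the dimension of the
Zariski tangent space). -/
def tangentSpace (I : Ideal (MvPolynomial (Fin 4) k)) (P : ℙ k (Fin 4 → k)) :
    Submodule k (Fin 4 → k) where
  carrier := {w | ∀ g ∈ I, ∑ i, MvPolynomial.eval P.rep (MvPolynomial.pderiv i g) * w i = 0}
  zero_mem' := by
    intro g _
    simp
  add_mem' := by
    intro a b ha hb g hg
    have h1 := ha g hg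
    have h2 := hb g hg
    simp only [Pi.add_apply, mul_add, Finset.sum_add_distrib, h1, h2, add_zero]
  smul_mem' := by
    intro c a ha g hg
    have h1 := ha g hg
    simp only [Pi.smul_apply, smul_eq_mul, mul_left_comm _ c, ← Finset.mul_sum, h1, mul_zero]

/-- `P` is a singular point of the curve in `ℙ³` with homogeneous ideal `I`: it lies on the curve,
and the Zariski tangent space there has dimension greater than one. -/
def IsSingularPoint (I : Ideal (MvPolynomial (Fin 4) k)) (P : ℙ k (Fin 4 → k)) : Prop :=
  OnScheme I P ∧ 2 < Module.finrank k (tangentSpace I P)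

/-- The function field of the integral projective variety in `ℙ³` with homogeneous prime ideal `I`:
inside the fraction field of the homogeneous coordinate ring it is generated over `k` by the ratios
of the coordinate functions (a ratio with denominator zero is zero in Lean, hence harmless). -/
def functionField (I : Ideal (MvPolynomial (Fin 4) k)) [I.IsPrime] :
    IntermediateField k (FractionRing (MvPolynomial (Fin 4) k ⧸ I)) :=
  IntermediateField.adjoin k
    {z | ∃ i j : Fin 4, z =
      algebraMap (MvPolynomial (Fin 4) k ⧸ I) (FractionRing (MvPolynomial (Fin 4) k ⧸ I))
          (Ideal.Quotient.mk I (MvPolynomial.X i)) /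
        algebraMap (MvPolynomial (Fin 4) k ⧸ I) (FractionRing (MvPolynomial (Fin 4) k ⧸ I))
          (Ideal.Quotient.mk I (MvPolynomial.X j))}

/-- The closed subscheme of `ℙ³` with homogeneous ideal `I` is an integral rational curve: `I` is
prime and the function field is purely transcendental of transcendence degree one over `k`. -/
def IsRationalCurve (I : Ideal (MvPolynomial (Fin 4) k)) : Prop :=
  ∃ _ : I.IsPrime, Nonempty (functionField I ≃ₐ[k] RatFunc k)

/-- `L`, a two-dimensional subspace of `k⁴`, is a line of `ℙ³` contained in the surface `S`. -/
def IsLineOnSurface (q : ℕ) (L : Submodule k (Fin 4 → k)) : Prop :=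
  Module.finrank k L = 2 ∧ ∀ x ∈ L, MvPolynomial.eval x (surfaceForm k q) = 0

/-- The base `ℙ¹` of the pencil: the set of planes of `ℙ³` containing the line `L`. -/
def pencil (L : Submodule k (Fin 4 → k)) : Set (Submodule k (Fin 4 → k)) :=
  {H | Module.finrank k H = 3 ∧ L ≤ H}

open Classical in
/-- The map `f : S → ℙ¹` of the pencil of planes through the line `L`. It sends a point off the line
to the plane that it spans with the line, and it is extended to the line by the tangent plane. -/
def pencilMap (q : ℕ) (L : Submodule k (Fin 4 → k)) (P : ℙ k (Fin 4 → k)) :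
    Submodule k (Fin 4 → k) :=
  if P.submodule ≤ L then tangentSpace (surfaceIdeal k q) P else L ⊔ P.submodule

/-- The homogeneous ideal of the fiber of the pencil over the plane `H`. The fiber is the member of
the moving part of the pencil of plane sections of `S` through `L`, that is, the residual scheme of
the line `L` in the plane section `S ∩ H`, given by the ideal quotient `(I(S) + I(H)) : I(L)`. -/
def fiberIdeal (q : ℕ) (L H : Submodule k (Fin 4 → k)) : Ideal (MvPolynomial (Fin 4) k) :=
  (surfaceIdeal k q ⊔ linearIdeal H).colon (linearIdeal L : Set (MvPolynomial (Fin 4) k))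

/-- The planes over which the fiber of the pencil is degenerate, that is, not an integral curve.
These are the singular fibers of the fibration (if `q > 2`, all fibers have a singular point). -/
def singularFibers (q : ℕ) (L : Submodule k (Fin 4 → k)) : Set (Submodule k (Fin 4 → k)) :=
  {H | H ∈ pencil L ∧ ¬ (fiberIdeal q L H).IsPrime}

/-- The lines `M` and `N` on the surface `S` meet at `P` and nowhere else, and they do so
transversely on `S`: their tangent directions at `P` span the tangent plane of `S` at `P`. -/
def MeetTransverselyAt (q : ℕ) (M N : Submodule k (Fin 4 → k)) (P : ℙ k (Fin 4 → k)) : Prop :=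
  M ⊓ N = P.submodule ∧ M ⊔ N = tangentSpace (surfaceIdeal k q) P

end HermitianPencil

end

/-!
The surface `S` is the zero locus of `B(x, φ x)`, where `B` is the alternating form `alt` on `k⁴` and
`φ` is the coordinatewise `q`-power map `frob`. As the differential of `x ^ q` vanishes, the tangent
plane of `S` at `x` is `(φ x)^⊥`. Polarizing the equation shows that a line `L` lies on `S` if and
only if `L ⊥ φ L`; counting dimensions, `L = (φ L)^⊥` and `L^⊥ = φ L`. Hence every plane `H ⊃ L` is
the tangent plane `(φ u)^⊥` at a unique point `u` of `L`, and the pencil is parametrized by `L`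
itself (`IsFrobeniusPower.exists_eq_tangentPlane`, `exists_eq_smul_of_tangentPlane_eq`).

Extend `u` to a basis `u, v` of `L` and `u, v, w` of `H` with `B(w, φ v) = 1`. In the corresponding
coordinates `y₀, y₁, y₂` on `H`, the equation of `S` becomes `y₂ G` with
`G = y₁ ^ q + y₂ ^ (q - 1) (α y₀ + β y₁ + γ y₂)`, and `G` is the equation of the fiber
(`PlaneCoordinates.fiberIdeal_eq`).

* If `α ≠ 0`, a change of basis brings `G` to the form `y₁ ^ q - y₂ ^ (q - 1) y₀`. This is
  irreducible, being linear in `y₀`; the curve is parametrized by `y₁ / y₂`, and its only candidate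
  for a singular point is `u`, which is singular exactly when `q ≠ 2`.
* If `α = 0`, then `β ≠ 0` (otherwise `φ w ⊥ L`, so `w ∈ L`), and `G` is a binary form whose
  dehomogenization `T ^ q + β T + γ` is separable. So the fiber consists of `q` distinct lines
  through `u`, and any two of them span `H`, the tangent plane at `u`.

Finally `α = B(u, φ w)` vanishes if and only if `u ⊥ φ H = (φ² u)^⊥`, that is, `φ² u` is proportional
to `u` (`PlaneCoordinates.coeff_zero_eq_zero_iff`). The line `L = (φ L)^⊥` is stable under `φ²`, so
its reduced echelon basis is fixed by `φ²`, and the points in question are those of a projective line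
over the field with `q ^ 2` elements: there are `q ^ 2 + 1` of them (`ncard_singularFibers`).
-/

noncomputable section

namespace HermitianPencil

open MvPolynomial

/-! ### Linear changes of variables, linear subspaces and residual curves -/

section LinearAlgebra

section Substitution

variable {k : Type*} [Field k] {σ τ : Type*}

/-- The linear form with the same values as the linear functional `f`. -/
def linearForm [Fintype σ] [DecidableEq σ] (f : (σ → k) →ₗ[k] k) : MvPolynomial σ k :=
  ∑ j, C (f (Pi.single j 1)) * X j

@[simp]
theorem eval_linearForm [Fintype σ] [DecidableEq σ] (f : (σ → k) →ₗ[k] k) (y : σ → k) :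
    eval y (linearForm f) = f y := by
  rw [LinearMap.pi_apply_eq_sum_univ f y]
  simp only [linearForm, map_sum, map_mul, eval_C, eval_X, smul_eq_mul]
  refine Finset.sum_congr rfl fun i _ => ?_
  rw [mul_comm]
  congr 2
  ext j
  simp [Pi.single_apply, eq_comm]

@[simp]
theorem pderiv_linearForm [Fintype σ] [DecidableEq σ] (f : (σ → k) →ₗ[k] k) (j : σ) :
    pderiv j (linearForm f) = C (f (Pi.single j 1)) := by
  simp only [linearForm, map_sum, pderiv_C_mul, pderiv_X]
  rw [Finset.sum_eq_single j]
  · simp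
  · intro l _ hl
    simp [Pi.single_eq_of_ne hl]
  · simp

/-- The linear change of variables along `T`: pulling polynomial functions on `k^τ` back to
`k^σ`. -/
def subst [Fintype σ] [DecidableEq σ] (T : (σ → k) →ₗ[k] (τ → k)) :
    MvPolynomial τ k →ₐ[k] MvPolynomial σ k :=
  aeval fun i => linearForm (LinearMap.proj i ∘ₗ T)

@[simp]
theorem eval_subst [Fintype σ] [DecidableEq σ] (T : (σ → k) →ₗ[k] (τ → k)) (y : σ → k)
    (g : MvPolynomial τ k) : eval y (subst T g) = eval (T y) g := by
  induction g using MvPolynomial.induction_on with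
  | C r => simp [subst]
  | add g h hg hh => simp [hg, hh]
  | mul_X g i hg =>
    rw [map_mul, map_mul, hg, map_mul, eval_X]
    simp [subst]

theorem subst_surjective [Infinite k] [Fintype σ] [DecidableEq σ] [Fintype τ]
    {T : (σ → k) →ₗ[k] (τ → k)} (hT : Function.Injective T) :
    Function.Surjective (subst T) := by
  classical
  obtain ⟨U, hU⟩ := T.exists_leftInverse_of_injective (LinearMap.ker_eq_bot.mpr hT)
  refine fun g => ⟨subst U g, MvPolynomial.funext fun y => ?_⟩
  rw [eval_subst, eval_subst, ← LinearMap.comp_apply, hU, LinearMap.id_apply]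

/-- A polynomial is divisible by the linear form `X i - r X j` if and only if it vanishes on the
hyperplane that this form defines. -/
theorem X_sub_C_mul_X_dvd_iff [Infinite k] [DecidableEq σ] {i j : σ} (hij : i ≠ j) (r : k)
    (h : MvPolynomial σ k) :
    X i - C r * X j ∣ h ↔ ∀ y : σ → k, y i = r * y j → eval y h = 0 := by
  constructor
  · rintro ⟨m, rfl⟩ y hy
    simp [hy]
  · intro H
    -- Modulo the linear form, `h` agrees with the result of replacing `X i` by `r X j` in it,
    -- and this result is zero because it vanishes everywhere.
    let s : σ → MvPolynomial σ k := Function.update X i (C r * X j)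
    have hmod : (Ideal.Quotient.mkₐ k (Ideal.span {X i - C r * X j})).comp (aeval s) =
        Ideal.Quotient.mkₐ k (Ideal.span {X i - C r * X j}) := by
      refine MvPolynomial.algHom_ext fun l => ?_
      rw [AlgHom.comp_apply, aeval_X]
      rcases eq_or_ne l i with rfl | hl
      · simp only [s, Function.update_self]
        refine (Ideal.Quotient.eq.mpr ?_).symm
        exact Ideal.mem_span_singleton_self _
      · simp [s, hl]
    have hzero : aeval s h = 0 := by
      refine MvPolynomial.funext fun y => ?_
      have h1 : eval y (aeval s h) = eval (Function.update y i (r * y j)) h := by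
        have : (aeval y).comp (aeval s) =
            (aeval (Function.update y i (r * y j)) : MvPolynomial σ k →ₐ[k] k) := by
          refine MvPolynomial.algHom_ext fun l => ?_
          rcases eq_or_ne l i with rfl | hl
          · simp [s]
          · simp [s, hl]
        simpa [aeval_eq_eval] using DFunLike.congr_fun this h
      rw [h1, map_zero]
      exact H _ (by simp [Function.update_of_ne hij.symm])
    rw [← Ideal.mem_span_singleton, ← Ideal.Quotient.eq_zero_iff_mem]
    have := DFunLike.congr_fun hmod h
    rw [AlgHom.comp_apply, hzero, map_zero] at this
    exact this.symm

/-- The chain rule for a linear change of variables. -/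
theorem sum_pderiv_subst [Fintype σ] [DecidableEq σ] [Fintype τ] (T : (σ → k) →ₗ[k] (τ → k))
    (y v : σ → k) (g : MvPolynomial τ k) :
    ∑ j, eval y (pderiv j (subst T g)) * v j = ∑ i, eval (T y) (pderiv i g) * T v i := by
  classical
  induction g using MvPolynomial.induction_on with
  | C r => simp [subst]
  | add g h hg hh => simp only [map_add, add_mul, Finset.sum_add_distrib, hg, hh]
  | mul_X g i hg =>
    have h1 : ∑ j, T (Pi.single j 1) i * v j = T v i := by
      simpa [linearForm] using eval_linearForm (LinearMap.proj i ∘ₗ T) v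
    have h2 : ∀ j, eval y (pderiv j (subst T (X i))) = T (Pi.single j 1) i := by
      simp [subst]
    have h3 : ∀ j, eval y (pderiv j (subst T (g * X i))) * v j =
        eval (T y) g * (T (Pi.single j 1) i * v j) +
          T y i * (eval y (pderiv j (subst T g)) * v j) := by
      intro j
      rw [map_mul, Derivation.leibniz, map_add, smul_eq_mul, smul_eq_mul, map_mul, map_mul, h2,
        eval_subst, eval_subst, eval_X]
      ring
    have h4 : ∀ l, eval (T y) (pderiv l (g * X i)) * T v l =
        eval (T y) g * (Pi.single (M := fun _ => k) i (T v i) l) +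
          T y i * (eval (T y) (pderiv l g) * T v l) := by
      intro l
      rw [Derivation.leibniz, map_add, smul_eq_mul, smul_eq_mul, map_mul, map_mul, eval_X,
        pderiv_X]
      rcases eq_or_ne l i with rfl | hl
      · simp
        ring
      · simp [Pi.single_eq_of_ne hl, Pi.single_eq_of_ne' hl]
        ring
    simp only [h3, h4, Finset.sum_add_distrib, ← Finset.mul_sum, h1, hg, Finset.sum_pi_single',
      Finset.mem_univ, if_true]

end Substitution

variable {k : Type*} [Field k]

/-- A linear subspace is the zero locus of its ideal. -/
theorem mem_of_forall_mem_linearIdeal {W : Submodule k (Fin 4 → k)} {x : Fin 4 → k}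
    (hx : ∀ g ∈ linearIdeal W, eval x g = 0) : x ∈ W := by
  by_contra h
  obtain ⟨f, hf, hW⟩ := Submodule.exists_le_ker_of_notMem h
  refine hf ?_
  rw [← eval_linearForm f]
  refine hx _ fun y hy => ?_
  rw [aeval_eq_eval]
  exact (eval_linearForm f y).trans (hW hy)

theorem eval_eq_zero_of_mem_linearIdeal {W : Submodule k (Fin 4 → k)} {x : Fin 4 → k}
    (hx : x ∈ W) {g : MvPolynomial (Fin 4) k} (hg : g ∈ linearIdeal W) : eval x g = 0 := by
  have := hg x hx
  rwa [aeval_eq_eval] at this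

theorem linearIdeal_le_iff {W V : Submodule k (Fin 4 → k)} :
    linearIdeal W ≤ linearIdeal V ↔ V ≤ W :=
  ⟨fun h _ hx => mem_of_forall_mem_linearIdeal fun _ hg =>
    eval_eq_zero_of_mem_linearIdeal hx (h hg), fun h _ hg x hx => hg x (h hx)⟩

theorem mem_linearIdeal_map {n : ℕ} {T : (Fin n → k) →ₗ[k] (Fin 4 → k)}
    {W : Submodule k (Fin n → k)} {g : MvPolynomial (Fin 4) k} :
    g ∈ linearIdeal (W.map T) ↔ ∀ y ∈ W, eval y (subst T g) = 0 := by
  simp [linearIdeal, mem_vanishingIdeal_iff, aeval_eq_eval]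

/-- The hyperplane `y i = r y j` in `k^n`. -/
def hyperplane {n : ℕ} (i j : Fin n) (r : k) : Submodule k (Fin n → k) :=
  LinearMap.ker (LinearMap.proj i - r • LinearMap.proj j : (Fin n → k) →ₗ[k] k)

@[simp]
theorem mem_hyperplane {n : ℕ} {i j : Fin n} {r : k} {y : Fin n → k} :
    y ∈ hyperplane i j r ↔ y i = r * y j := by
  simp [hyperplane, sub_eq_zero]

theorem linearIdeal_map_hyperplane [Infinite k] {n : ℕ} (T : (Fin n → k) →ₗ[k] (Fin 4 → k))
    {i j : Fin n} (hij : i ≠ j) (r : k) :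
    linearIdeal ((hyperplane i j r).map T) =
      (Ideal.span {X i - C r * X j}).comap (subst T) := by
  ext g
  rw [mem_linearIdeal_map, Ideal.mem_comap, Ideal.mem_span_singleton,
    X_sub_C_mul_X_dvd_iff hij]
  simp

theorem linearIdeal_range [Infinite k] {n : ℕ} (T : (Fin n → k) →ₗ[k] (Fin 4 → k)) :
    linearIdeal (LinearMap.range T) = (⊥ : Ideal (MvPolynomial (Fin n) k)).comap (subst T) := by
  ext g
  rw [← Submodule.map_top, mem_linearIdeal_map, Ideal.mem_comap, Ideal.mem_bot]
  exact ⟨fun h => MvPolynomial.funext fun y => by simpa using h y trivial, fun h => by simp [h]⟩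

/-- In coordinates `y` on the plane `H` in which the line `L` is `y 2 = 0`, the fiber is cut out by
the equation `G` of the surface divided by `y 2`. -/
theorem fiberIdeal_eq_comap [Infinite k] {q : ℕ} {L H : Submodule k (Fin 4 → k)}
    {T : (Fin 3 → k) →ₗ[k] (Fin 4 → k)} (hT : Function.Injective T)
    (hH : LinearMap.range T = H) (hL : (hyperplane 2 0 0).map T = L)
    {G : MvPolynomial (Fin 3) k} (hG : subst T (surfaceForm k q) = X 2 * G) :
    fiberIdeal q L H = (Ideal.span {G}).comap (subst T) := by
  have hsurj := subst_surjective hT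
  have hsup : surfaceIdeal k q ⊔ linearIdeal H = (Ideal.span {X 2 * G}).comap (subst T) := by
    rw [← hH, linearIdeal_range, ← Ideal.comap_map_of_surjective _ hsurj, surfaceIdeal,
      Ideal.map_span, Set.image_singleton, hG]
  have hLid : linearIdeal L = (Ideal.span {X 2}).comap (subst T) := by
    rw [← hL, linearIdeal_map_hyperplane T (by decide)]
    simp
  ext g
  rw [fiberIdeal, hsup, hLid, Submodule.mem_colon, Ideal.mem_comap, Ideal.mem_span_singleton]
  constructor
  · intro h
    obtain ⟨s, hs⟩ := hsurj (X 2)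
    have := h s (by simp [hs])
    rw [smul_eq_mul, Ideal.mem_comap, map_mul, hs, Ideal.mem_span_singleton] at this
    obtain ⟨m, hm⟩ := this
    exact ⟨m, mul_left_cancel₀ (X_ne_zero 2) (by rw [mul_comm, hm, mul_assoc])⟩
  · intro h s hs
    rw [SetLike.mem_coe, Ideal.mem_comap, Ideal.mem_span_singleton] at hs
    rw [smul_eq_mul, Ideal.mem_comap, map_mul, Ideal.mem_span_singleton, mul_comm (X 2)]
    exact mul_dvd_mul h hs

theorem onScheme_comap_iff [Infinite k] {n : ℕ} {T : (Fin n → k) →ₗ[k] (Fin 4 → k)}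
    (hT : Function.Injective T) (G : MvPolynomial (Fin n) k) (P : ℙ k (Fin 4 → k)) :
    OnScheme ((Ideal.span {G}).comap (subst T)) P ↔ ∃ y, T y = P.rep ∧ eval y G = 0 := by
  constructor
  · intro h
    obtain ⟨y, hy⟩ : P.rep ∈ LinearMap.range T := by
      refine mem_of_forall_mem_linearIdeal fun g hg => h g ?_
      rw [linearIdeal_range] at hg
      exact Ideal.comap_mono bot_le hg
    obtain ⟨g, hg⟩ := subst_surjective hT G
    refine ⟨y, hy, ?_⟩
    rw [← hg, eval_subst, hy]
    exact h g (by simp [Ideal.mem_comap, hg])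
  · rintro ⟨y, hy, hG⟩ g hg
    obtain ⟨m, hm⟩ := Ideal.mem_span_singleton.mp (Ideal.mem_comap.mp hg)
    rw [← hy, ← eval_subst, hm, map_mul, hG, zero_mul]

theorem mem_tangentSpace {I : Ideal (MvPolynomial (Fin 4) k)} {P : ℙ k (Fin 4 → k)}
    {w : Fin 4 → k} :
    w ∈ tangentSpace I P ↔ ∀ g ∈ I, ∑ i, eval P.rep (pderiv i g) * w i = 0 := Iff.rfl

/-- The embedded tangent space of a plane curve, computed in coordinates on the plane. -/
theorem mem_tangentSpace_comap_iff [Infinite k] {n : ℕ} {T : (Fin n → k) →ₗ[k] (Fin 4 → k)}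
    (hT : Function.Injective T) {G : MvPolynomial (Fin n) k} {P : ℙ k (Fin 4 → k)} {y : Fin n → k}
    (hy : T y = P.rep) (hG : eval y G = 0) (w : Fin 4 → k) :
    w ∈ tangentSpace ((Ideal.span {G}).comap (subst T)) P ↔
      ∃ v, T v = w ∧ ∑ j, eval y (pderiv j G) * v j = 0 := by
  rw [mem_tangentSpace]
  constructor
  · intro h
    obtain ⟨v, hv⟩ : w ∈ LinearMap.range T := by
      by_contra hw
      obtain ⟨f, hf, hW⟩ := Submodule.exists_le_ker_of_notMem hw
      refine hf ?_
      have := h (linearForm f) ?_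
      · simp only [pderiv_linearForm, eval_C] at this
        rw [← eval_linearForm f w]
        simpa [linearForm] using this
      · refine Ideal.comap_mono bot_le ?_
        rw [← linearIdeal_range]
        exact fun x hx => (eval_linearForm f x).trans (hW hx)
    obtain ⟨g, hg⟩ := subst_surjective hT G
    refine ⟨v, hv, ?_⟩
    rw [← hg, sum_pderiv_subst, hy, hv]
    exact h g (by simp [Ideal.mem_comap, hg])
  · rintro ⟨v, rfl, hv⟩ g hg
    obtain ⟨m, hm⟩ := Ideal.mem_span_singleton.mp (Ideal.mem_comap.mp hg)
    rw [← hy, ← sum_pderiv_subst, hm]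
    have h1 : ∀ j, eval y (pderiv j (G * m)) * v j =
        eval y m * (eval y (pderiv j G) * v j) := by
      intro j
      simp only [Derivation.leibniz, smul_eq_mul, map_add, map_mul, hG]
      ring
    simp only [h1, ← Finset.mul_sum, hv, mul_zero]

/-- A point of a plane curve is singular if and only if all partial derivatives of the equation
vanish there. -/
theorem isSingularPoint_comap_iff [Infinite k] {T : (Fin 3 → k) →ₗ[k] (Fin 4 → k)}
    (hT : Function.Injective T) (G : MvPolynomial (Fin 3) k) (P : ℙ k (Fin 4 → k)) :
    IsSingularPoint ((Ideal.span {G}).comap (subst T)) P ↔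
      ∃ y, T y = P.rep ∧ eval y G = 0 ∧ ∀ j, eval y (pderiv j G) = 0 := by
  have hrange : Module.finrank k (LinearMap.range T) = 3 := by
    rw [LinearMap.finrank_range_of_inj hT, Module.finrank_fin_fun]
  rw [IsSingularPoint, onScheme_comap_iff hT]
  constructor
  · rintro ⟨⟨y, hy, hG⟩, hdim⟩
    refine ⟨y, hy, hG, fun j => ?_⟩
    have hle : tangentSpace ((Ideal.span {G}).comap (subst T)) P ≤ LinearMap.range T := by
      intro w hw
      obtain ⟨v, hv, -⟩ := (mem_tangentSpace_comap_iff hT hy hG w).mp hw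
      exact ⟨v, hv⟩
    have heq := Submodule.eq_of_le_of_finrank_le hle (by rw [hrange]; exact hdim)
    have hmem : T (Pi.single j 1) ∈ tangentSpace ((Ideal.span {G}).comap (subst T)) P := by
      rw [heq]
      exact ⟨_, rfl⟩
    obtain ⟨v, hv, hsum⟩ := (mem_tangentSpace_comap_iff hT hy hG _).mp hmem
    rw [hT hv] at hsum
    simpa [Pi.single_apply] using hsum
  · rintro ⟨y, hy, hG, hd⟩
    refine ⟨⟨y, hy, hG⟩, ?_⟩
    have hle : LinearMap.range T ≤ tangentSpace ((Ideal.span {G}).comap (subst T)) P := by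
      rintro _ ⟨v, rfl⟩
      exact (mem_tangentSpace_comap_iff hT hy hG _).mpr ⟨v, rfl, by simp [hd]⟩
    have := Submodule.finrank_mono hle
    omega

end LinearAlgebra

/-! ### The alternating form, tangent planes and lines on the surface -/

section Surface

variable {k : Type*} [Field k] {q : ℕ}

/-- The exponent `q` is a positive power of the characteristic of `k`, in the form of the
properties that matter for the geometry of the surface. -/
structure IsFrobeniusPower (k : Type*) [Field k] (q : ℕ) : Prop where
  two_le : 2 ≤ q
  cast_eq_zero : (q : k) = 0
  add_pow : ∀ x y : k, (x + y) ^ q = x ^ q + y ^ q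

theorem isFrobeniusPower_pow (k : Type*) [Field k] (p a : ℕ) [Fact p.Prime] [CharP k p]
    (ha : 0 < a) : IsFrobeniusPower k (p ^ a) where
  two_le := (Fact.out : p.Prime).two_le.trans (Nat.le_self_pow ha.ne' p)
  cast_eq_zero := by
    rw [Nat.cast_pow, CharP.cast_eq_zero, zero_pow ha.ne']
  add_pow x y := by
    have : ExpChar k p := .prime Fact.out
    exact add_pow_expChar_pow x y p a

theorem IsFrobeniusPower.ne_zero (hq : IsFrobeniusPower k q) : q ≠ 0 := by
  have := hq.two_le
  omega

theorem IsFrobeniusPower.sub_pow (hq : IsFrobeniusPower k q) (x y : k) :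
    (x - y) ^ q = x ^ q - y ^ q := by
  rw [eq_sub_iff_add_eq, ← hq.add_pow, sub_add_cancel]

/-- The coordinatewise `q`-power map on `k⁴`. -/
def frob (q : ℕ) (x : Fin 4 → k) : Fin 4 → k := fun i => x i ^ q

@[simp]
theorem frob_apply (x : Fin 4 → k) (i : Fin 4) : frob q x i = x i ^ q := rfl

theorem frob_smul (c : k) (x : Fin 4 → k) : frob q (c • x) = c ^ q • frob q x := by
  ext i
  simp [mul_pow]

theorem IsFrobeniusPower.frob_add (hq : IsFrobeniusPower k q) (x y : Fin 4 → k) :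
    frob q (x + y) = frob q x + frob q y := by
  ext i
  simp [hq.add_pow]

theorem IsFrobeniusPower.frob_eq_zero (hq : IsFrobeniusPower k q) {x : Fin 4 → k} :
    frob q x = 0 ↔ x = 0 := by
  simp [funext_iff, pow_eq_zero_iff hq.ne_zero]

theorem IsFrobeniusPower.frob_surjective [IsAlgClosed k] (hq : IsFrobeniusPower k q) :
    Function.Surjective (frob (k := k) q) := by
  intro y
  choose x hx using fun i => IsAlgClosed.exists_pow_nat_eq (y i) hq.ne_zero.bot_lt
  exact ⟨x, funext hx⟩

/-- The alternating form `x₀ y₁ - x₁ y₀ + x₂ y₃ - x₃ y₂` on `k⁴`. -/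
def alt : LinearMap.BilinForm k (Fin 4 → k) :=
  LinearMap.mk₂ k (fun x y => x 0 * y 1 - x 1 * y 0 + x 2 * y 3 - x 3 * y 2)
    (by intros; simp only [Pi.add_apply]; ring)
    (by intros; simp only [Pi.smul_apply, smul_eq_mul]; ring)
    (by intros; simp only [Pi.add_apply]; ring)
    (by intros; simp only [Pi.smul_apply, smul_eq_mul]; ring)

theorem alt_apply (x y : Fin 4 → k) :
    alt x y = x 0 * y 1 - x 1 * y 0 + x 2 * y 3 - x 3 * y 2 := rfl

theorem alt_swap (x y : Fin 4 → k) : alt x y = -alt y x := by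
  simp only [alt_apply]
  ring

theorem alt_isRefl : (alt (k := k)).IsRefl := fun x y h => by rw [alt_swap, h, neg_zero]

theorem alt_nondegenerate : (alt (k := k)).Nondegenerate := by
  refine (LinearMap.IsRefl.nondegenerate_iff_separatingLeft fun x y h => alt_isRefl x y h).mpr
    fun x hx => ?_
  ext i
  have h0 := hx (Pi.single 0 1)
  have h1 := hx (Pi.single 1 1)
  have h2 := hx (Pi.single 2 1)
  have h3 := hx (Pi.single 3 1)
  simp [alt_apply] at h0 h1 h2 h3
  fin_cases i <;> simp [*]

theorem IsFrobeniusPower.alt_frob_frob (hq : IsFrobeniusPower k q) (x y : Fin 4 → k) :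
    alt (frob q x) (frob q y) = alt x y ^ q := by
  simp only [alt_apply, frob_apply, hq.sub_pow, hq.add_pow, mul_pow]

/-- The equation of the surface is the alternating form of a vector with its Frobenius twist. -/
theorem eval_surfaceForm (x : Fin 4 → k) : eval x (surfaceForm k q) = alt x (frob q x) := by
  simp [surfaceForm, alt_apply]

theorem onScheme_surfaceIdeal_iff {P : ℙ k (Fin 4 → k)} :
    OnScheme (surfaceIdeal k q) P ↔ alt P.rep (frob q P.rep) = 0 := by
  rw [← eval_surfaceForm]
  refine ⟨fun h => h _ (Ideal.mem_span_singleton_self _), fun h g hg => ?_⟩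
  obtain ⟨m, rfl⟩ := Ideal.mem_span_singleton.mp hg
  rw [map_mul, h, zero_mul]

/-- The plane `{w | alt w (frob q u) = 0}`, which is tangent to the surface at `u` if `u` lies on
the surface. -/
def tangentPlane (q : ℕ) (u : Fin 4 → k) : Submodule k (Fin 4 → k) :=
  LinearMap.ker (alt.flip (frob q u))

@[simp]
theorem mem_tangentPlane {u w : Fin 4 → k} : w ∈ tangentPlane q u ↔ alt w (frob q u) = 0 := Iff.rfl

theorem orthogonal_span_singleton (v : Fin 4 → k) :
    alt.orthogonal (k ∙ v) = LinearMap.ker (alt.flip v) := by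
  ext w
  rw [LinearMap.BilinForm.mem_orthogonal_iff]
  constructor
  · intro h
    exact alt_isRefl _ _ (h v (Submodule.mem_span_singleton_self v))
  · intro h n hn
    obtain ⟨c, rfl⟩ := Submodule.mem_span_singleton.mp hn
    have : alt v w = 0 := alt_isRefl _ _ h
    simp [this]

theorem finrank_ker_alt_flip {v : Fin 4 → k} (hv : v ≠ 0) :
    Module.finrank k (LinearMap.ker (alt.flip v)) = 3 := by
  rw [← orthogonal_span_singleton, LinearMap.BilinForm.finrank_orthogonal alt_nondegenerate,
    finrank_span_singleton hv, Module.finrank_fin_fun]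

theorem IsFrobeniusPower.finrank_tangentPlane (hq : IsFrobeniusPower k q) {u : Fin 4 → k}
    (hu : u ≠ 0) : Module.finrank k (tangentPlane q u) = 3 :=
  finrank_ker_alt_flip (mt hq.frob_eq_zero.mp hu)

theorem tangentPlane_smul {c : k} (hc : c ≠ 0) (u : Fin 4 → k) :
    tangentPlane q (c • u) = tangentPlane q u := by
  ext w
  simp [frob_smul, hc]

/-- The tangent space of the surface is given by the polar plane, because the differential of
`x ^ q` vanishes. -/
theorem IsFrobeniusPower.tangentSpace_surfaceIdeal (hq : IsFrobeniusPower k q)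
    {P : ℙ k (Fin 4 → k)} (hP : OnScheme (surfaceIdeal k q) P) :
    tangentSpace (surfaceIdeal k q) P = tangentPlane q P.rep := by
  have hsum : ∀ w : Fin 4 → k, ∑ i, eval P.rep (pderiv i (surfaceForm k q)) * w i =
      alt w (frob q P.rep) := by
    intro w
    simp [surfaceForm, Fin.sum_univ_four, pderiv_X, Pi.single_apply, Derivation.leibniz,
      Derivation.leibniz_pow, hq.cast_eq_zero, alt_apply]
    ring
  ext w
  rw [mem_tangentSpace, mem_tangentPlane, ← hsum]
  refine ⟨fun h => h _ (Ideal.mem_span_singleton_self _), fun h g hg => ?_⟩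
  obtain ⟨m, rfl⟩ := Ideal.mem_span_singleton.mp hg
  have hF := hP _ (Ideal.mem_span_singleton_self _)
  have h1 : ∀ i, eval P.rep (pderiv i (surfaceForm k q * m)) * w i =
      eval P.rep m * (eval P.rep (pderiv i (surfaceForm k q)) * w i) := by
    intro i
    simp only [Derivation.leibniz, smul_eq_mul, map_add, map_mul, hF]
    ring
  simp only [h1, ← Finset.mul_sum, h, mul_zero]

section Line

variable {L : Submodule k (Fin 4 → k)}

/-- A line on the surface is isotropic for the form `alt x (frob q y)`. -/
theorem IsFrobeniusPower.alt_frob_eq_zero [Infinite k] (hq : IsFrobeniusPower k q)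
    (hL : IsLineOnSurface q L) {x y : Fin 4 → k} (hx : x ∈ L) (hy : y ∈ L) :
    alt x (frob q y) = 0 := by
  -- The equation at `x + t y` is a polynomial in `t` that vanishes identically; its coefficient
  -- at `t ^ q` is the number in question.
  have h0 : ∀ z ∈ L, alt z (frob q z) = 0 := fun z hz => by
    rw [← eval_surfaceForm]
    exact hL.2 z hz
  have h1 : ∀ t : k, t ^ q * alt x (frob q y) + t * alt y (frob q x) = 0 := by
    intro t
    have := h0 (x + t • y) (L.add_mem hx (L.smul_mem t hy))
    simp only [hq.frob_add, frob_smul, map_add, map_smul, LinearMap.add_apply,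
      LinearMap.smul_apply, smul_eq_mul, h0 x hx, h0 y hy] at this
    linear_combination this
  have hpoly : (Polynomial.C (alt x (frob q y)) * Polynomial.X ^ q +
      Polynomial.C (alt y (frob q x)) * Polynomial.X : Polynomial k) = 0 := by
    refine Polynomial.funext fun t => ?_
    simp only [Polynomial.eval_add, Polynomial.eval_mul, Polynomial.eval_C, Polynomial.eval_pow,
      Polynomial.eval_X, Polynomial.eval_zero]
    linear_combination h1 t
  have hcoeff := congrArg (fun f : Polynomial k => f.coeff q) hpoly
  have h1q : ¬ 1 = q := by have := hq.two_le; omega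
  simpa [Polynomial.coeff_X, h1q] using hcoeff

theorem exists_basis_of_finrank_eq_two (hL : Module.finrank k L = 2) :
    ∃ x ∈ L, ∃ y ∈ L, LinearIndependent k ![x, y] := by
  let b := Module.finBasisOfFinrankEq k L hL
  refine ⟨b 0, (b 0).2, b 1, (b 1).2, ?_⟩
  have := LinearIndependent.pair_iff.mp (show LinearIndependent k ![b 0, b 1] by
    convert b.linearIndependent using 1
    ext i
    fin_cases i <;> rfl)
  rw [LinearIndependent.pair_iff]
  exact fun s t hst => this s t (Subtype.ext hst)

theorem finrank_span_pair {x y : Fin 4 → k} (h : LinearIndependent k ![x, y]) :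
    Module.finrank k (Submodule.span k {x, y}) = 2 := by
  have := finrank_span_eq_card h
  rwa [Matrix.range_cons, Matrix.range_cons, Matrix.range_empty, Set.union_empty,
    Set.singleton_union, Fintype.card_fin] at this

theorem pencilMap_of_notMem {P : ℙ k (Fin 4 → k)} (hP : P.rep ∉ L) :
    pencilMap q L P = L ⊔ k ∙ P.rep := by
  rw [pencilMap, if_neg, P.submodule_eq]
  rwa [P.submodule_eq, Submodule.span_singleton_le_iff_mem]

theorem sup_span_singleton_mem_pencil (hL : Module.finrank k L = 2) {x : Fin 4 → k}
    (hx : x ∉ L) : L ⊔ k ∙ x ∈ pencil L := by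
  refine ⟨?_, le_sup_left⟩
  have h1 := Submodule.finrank_sup_add_finrank_inf_eq L (k ∙ x)
  have hx0 : x ≠ 0 := fun h => hx (h ▸ L.zero_mem)
  have hinf : L ⊓ (k ∙ x) = ⊥ :=
    ((Submodule.disjoint_span_singleton' hx0).mpr hx).eq_bot
  rw [hinf, finrank_bot, hL, finrank_span_singleton hx0] at h1
  exact h1

variable [IsAlgClosed k]

theorem IsFrobeniusPower.linearIndependent_frob (hq : IsFrobeniusPower k q)
    {x y : Fin 4 → k} (h : LinearIndependent k ![x, y]) :
    LinearIndependent k ![frob q x, frob q y] := by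
  rw [LinearIndependent.pair_iff] at h ⊢
  intro s t hst
  obtain ⟨s, rfl⟩ := IsAlgClosed.exists_pow_nat_eq s hq.ne_zero.bot_lt
  obtain ⟨t, rfl⟩ := IsAlgClosed.exists_pow_nat_eq t hq.ne_zero.bot_lt
  rw [← frob_smul, ← frob_smul, ← hq.frob_add, hq.frob_eq_zero] at hst
  simpa [pow_eq_zero_iff hq.ne_zero] using h s t hst

/-- The orthogonal complement of a line on the surface is the Frobenius twist of the line. -/
theorem IsFrobeniusPower.exists_frob_eq (hq : IsFrobeniusPower k q)
    (hL : IsLineOnSurface q L) {v : Fin 4 → k} (hv : ∀ x ∈ L, alt x v = 0) :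
    ∃ u ∈ L, frob q u = v := by
  obtain ⟨x, hx, y, hy, hxy⟩ := exists_basis_of_finrank_eq_two hL.1
  have hle : Submodule.span k {frob q x, frob q y} ≤ alt.orthogonal L := by
    rw [Submodule.span_le]
    rintro _ (rfl | rfl) z hz
    · exact hq.alt_frob_eq_zero hL hz hx
    · exact hq.alt_frob_eq_zero hL hz hy
  have heq := Submodule.eq_of_le_of_finrank_eq hle (by
    rw [finrank_span_pair (hq.linearIndependent_frob hxy),
      LinearMap.BilinForm.finrank_orthogonal alt_nondegenerate, hL.1, Module.finrank_fin_fun])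
  have hmem : v ∈ Submodule.span k {frob q x, frob q y} := by
    rw [heq]
    exact hv
  obtain ⟨s, t, rfl⟩ := Submodule.mem_span_pair.mp hmem
  obtain ⟨s, rfl⟩ := IsAlgClosed.exists_pow_nat_eq s hq.ne_zero.bot_lt
  obtain ⟨t, rfl⟩ := IsAlgClosed.exists_pow_nat_eq t hq.ne_zero.bot_lt
  exact ⟨s • x + t • y, L.add_mem (L.smul_mem s hx) (L.smul_mem t hy), by
    rw [hq.frob_add, frob_smul, frob_smul]⟩

/-- A line on the surface is the orthogonal complement of its Frobenius twist. -/
theorem IsFrobeniusPower.mem_line_of_forall (hq : IsFrobeniusPower k q)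
    (hL : IsLineOnSurface q L) {w : Fin 4 → k} (hw : ∀ x ∈ L, alt w (frob q x) = 0) :
    w ∈ L := by
  obtain ⟨x, hx, y, hy, hxy⟩ := exists_basis_of_finrank_eq_two hL.1
  have hmem : ∀ z : Fin 4 → k, z ∈ alt.orthogonal (Submodule.span k {frob q x, frob q y}) ↔
      alt z (frob q x) = 0 ∧ alt z (frob q y) = 0 := by
    intro z
    rw [LinearMap.BilinForm.mem_orthogonal_iff]
    constructor
    · intro h
      exact ⟨alt_isRefl _ _ (h _ (Submodule.subset_span (by simp))),
        alt_isRefl _ _ (h _ (Submodule.subset_span (by simp)))⟩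
    · rintro ⟨h1, h2⟩ n hn
      obtain ⟨s, t, rfl⟩ := Submodule.mem_span_pair.mp hn
      refine alt_isRefl _ _ ?_
      simp [h1, h2]
  have hle : L ≤ alt.orthogonal (Submodule.span k {frob q x, frob q y}) := fun z hz =>
    (hmem z).mpr ⟨hq.alt_frob_eq_zero hL hz hx, hq.alt_frob_eq_zero hL hz hy⟩
  have heq := Submodule.eq_of_le_of_finrank_eq hle (by
    rw [LinearMap.BilinForm.finrank_orthogonal alt_nondegenerate, hL.1, Module.finrank_fin_fun,
      finrank_span_pair (hq.linearIndependent_frob hxy)])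
  rw [heq, hmem]
  exact ⟨hw x hx, hw y hy⟩

theorem IsFrobeniusPower.tangentPlane_mem_pencil (hq : IsFrobeniusPower k q)
    (hL : IsLineOnSurface q L) {u : Fin 4 → k} (hu : u ∈ L) (hu0 : u ≠ 0) :
    tangentPlane q u ∈ pencil L :=
  ⟨hq.finrank_tangentPlane hu0, fun _ hx => hq.alt_frob_eq_zero hL hx hu⟩

/-- Every plane through a line on the surface is tangent to the surface at a point of the line. -/
theorem IsFrobeniusPower.exists_eq_tangentPlane (hq : IsFrobeniusPower k q)
    (hL : IsLineOnSurface q L) {H : Submodule k (Fin 4 → k)} (hH : H ∈ pencil L) :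
    ∃ u ∈ L, u ≠ 0 ∧ H = tangentPlane q u := by
  have hfin : Module.finrank k (alt.orthogonal H) = 1 := by
    rw [LinearMap.BilinForm.finrank_orthogonal alt_nondegenerate, hH.1, Module.finrank_fin_fun]
  obtain ⟨v, hv, hv0⟩ := Submodule.exists_mem_ne_zero_of_ne_bot
    (Submodule.one_le_finrank_iff.mp hfin.ge)
  obtain ⟨u, hu, rfl⟩ := hq.exists_frob_eq hL fun x hx => hv x (hH.2 hx)
  have hu0 : u ≠ 0 := fun h => hv0 (hq.frob_eq_zero.mpr h)
  exact ⟨u, hu, hu0, Submodule.eq_of_le_of_finrank_eq (fun x hx => hv x hx)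
    (by rw [hH.1, hq.finrank_tangentPlane hu0])⟩

theorem pencilMap_of_mem (hq : IsFrobeniusPower k q) (hL : IsLineOnSurface q L)
    {P : ℙ k (Fin 4 → k)} (hP : P.rep ∈ L) : pencilMap q L P = tangentPlane q P.rep := by
  rw [pencilMap, if_pos, hq.tangentSpace_surfaceIdeal]
  · exact onScheme_surfaceIdeal_iff.mpr (hq.alt_frob_eq_zero hL hP hP)
  · rwa [P.submodule_eq, Submodule.span_singleton_le_iff_mem]

theorem pencilMap_mem_pencil (hq : IsFrobeniusPower k q) (hL : IsLineOnSurface q L)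
    (P : ℙ k (Fin 4 → k)) : pencilMap q L P ∈ pencil L := by
  by_cases hP : P.rep ∈ L
  · rw [pencilMap_of_mem hq hL hP]
    exact hq.tangentPlane_mem_pencil hL hP P.rep_nonzero
  · rw [pencilMap_of_notMem hP]
    exact sup_span_singleton_mem_pencil hL.1 hP

end Line

end Surface

/-! ### Coordinates on the planes through a line -/

section Coordinates

variable {k : Type*} [Field k] {q : ℕ} {L H : Submodule k (Fin 4 → k)}

/-- Linear coordinates on a plane `H` through a line `L` of the surface, given by a
parametrization. The vector `toMap (1, 0, 0)` is the point of `L` at which `H` is tangent to the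
surface, and `toMap (0, 0, 1)`, which lies outside `L`, is scaled so that it pairs to `1` with the
Frobenius twist of `toMap (0, 1, 0)`. -/
structure PlaneCoordinates (q : ℕ) (L H : Submodule k (Fin 4 → k)) where
  /-- The parametrization of the plane. -/
  toMap : (Fin 3 → k) →ₗ[k] (Fin 4 → k)
  injective : Function.Injective toMap
  range_eq : LinearMap.range toMap = H
  map_eq : (hyperplane 2 0 0).map toMap = L
  polar : ∀ h ∈ H, alt h (frob q (toMap (Pi.single 0 1))) = 0
  pairing : alt (toMap (Pi.single 2 1)) (frob q (toMap (Pi.single 1 1))) = 1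

/-- The parametrization of a plane by three spanning vectors. -/
def combination (u v w : Fin 4 → k) : (Fin 3 → k) →ₗ[k] (Fin 4 → k) :=
  Fintype.linearCombination k ![u, v, w]

theorem combination_apply (u v w : Fin 4 → k) (y : Fin 3 → k) :
    combination u v w y = y 0 • u + y 1 • v + y 2 • w := by
  simp [combination, Fintype.linearCombination_apply, Fin.sum_univ_three]

theorem finrank_hyperplane {n : ℕ} {i j : Fin n} (hij : i ≠ j) (r : k) :
    Module.finrank k (hyperplane i j r) + 1 = n := by
  have hne : (LinearMap.proj i - r • LinearMap.proj j : (Fin n → k) →ₗ[k] k) ≠ 0 := fun h => by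
    simpa [Pi.single_eq_of_ne hij.symm] using DFunLike.congr_fun h (Pi.single i 1)
  have h1 := LinearMap.finrank_range_add_finrank_ker
    (LinearMap.proj i - r • LinearMap.proj j : (Fin n → k) →ₗ[k] k)
  rw [LinearMap.range_eq_top.mpr (LinearMap.surjective hne), finrank_top, Module.finrank_self,
    Module.finrank_fin_fun, add_comm] at h1
  exact h1

theorem finrank_map_hyperplane {n : ℕ} {T : (Fin n → k) →ₗ[k] (Fin 4 → k)}
    (hT : Function.Injective T) {i j : Fin n} (hij : i ≠ j) (r : k) :
    Module.finrank k ((hyperplane i j r).map T) + 1 = n := by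
  rw [← (Submodule.equivMapOfInjective T hT (hyperplane i j r)).finrank_eq,
    finrank_hyperplane hij]

theorem exists_planeCoordinates [IsAlgClosed k] (hq : IsFrobeniusPower k q)
    (hL : IsLineOnSurface q L) (hH : H ∈ pencil L) {u v w : Fin 4 → k} (hu : u ∈ L) (hv : v ∈ L)
    (hw : w ∈ H) (hu0 : u ≠ 0) (hpol : ∀ h ∈ H, alt h (frob q u) = 0)
    (hwv : alt w (frob q v) = 1) :
    ∃ E : PlaneCoordinates q L H, E.toMap = combination u v w := by
  have hinj : Function.Injective (combination u v w) := by
    rw [injective_iff_map_eq_zero]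
    intro y hy
    rw [combination_apply] at hy
    have h2 : y 2 = 0 := by
      have := congrArg (fun z => alt z (frob q v)) hy
      simpa [hq.alt_frob_eq_zero hL hu hv, hq.alt_frob_eq_zero hL hv hv, hwv] using this
    rw [h2, zero_smul, add_zero] at hy
    have h1 : y 1 = 0 := by
      have := congrArg (fun z => alt w (frob q z)) hy
      simp only [hq.frob_add, frob_smul, map_add, map_smul, hpol w hw, hwv,
        hq.frob_eq_zero.mpr rfl, map_zero] at this
      simpa [hq.ne_zero] using this
    have h0 : y 0 = 0 := by
      simpa [h1, hu0] using hy
    ext i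
    fin_cases i <;> assumption
  have hrange : LinearMap.range (combination u v w) = H := by
    refine Submodule.eq_of_le_of_finrank_eq ?_ ?_
    · rintro _ ⟨y, rfl⟩
      rw [combination_apply]
      exact H.add_mem (H.add_mem (H.smul_mem _ (hH.2 hu)) (H.smul_mem _ (hH.2 hv)))
        (H.smul_mem _ hw)
    · rw [LinearMap.finrank_range_of_inj hinj, Module.finrank_fin_fun, hH.1]
  have hmap : (hyperplane 2 0 0).map (combination u v w) = L := by
    refine Submodule.eq_of_le_of_finrank_eq ?_ ?_
    · rintro _ ⟨y, hy, rfl⟩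
      rw [SetLike.mem_coe, mem_hyperplane, zero_mul] at hy
      rw [combination_apply, hy, zero_smul, add_zero]
      exact L.add_mem (L.smul_mem _ hu) (L.smul_mem _ hv)
    · have := finrank_map_hyperplane hinj (show (2 : Fin 3) ≠ 0 by decide) 0
      rw [hL.1]
      omega
  exact ⟨⟨combination u v w, hinj, hrange, hmap, by simpa [combination_apply] using hpol,
    by simpa [combination_apply] using hwv⟩, rfl⟩

theorem exists_planeCoordinates_tangentPlane [IsAlgClosed k] (hq : IsFrobeniusPower k q)
    (hL : IsLineOnSurface q L) {u : Fin 4 → k} (hu : u ∈ L) (hu0 : u ≠ 0) :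
    ∃ E : PlaneCoordinates q L (tangentPlane q u), E.toMap (Pi.single 0 1) = u := by
  have hH := hq.tangentPlane_mem_pencil hL hu hu0
  obtain ⟨w, hw, hwL⟩ : ∃ w ∈ tangentPlane q u, w ∉ L := by
    by_contra! hcon
    have := Submodule.finrank_mono (show tangentPlane q u ≤ L from hcon)
    rw [hH.1, hL.1] at this
    omega
  obtain ⟨v, hv, hwv⟩ : ∃ v ∈ L, alt w (frob q v) ≠ 0 := by
    by_contra! hcon
    exact hwL (hq.mem_line_of_forall hL hcon)
  obtain ⟨E, hE⟩ := exists_planeCoordinates hq hL hH hu hv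
    (Submodule.smul_mem _ (alt w (frob q v))⁻¹ hw) hu0 (fun _ h => h) (by simp [hwv])
  exact ⟨E, by simp [hE, combination_apply]⟩

namespace PlaneCoordinates

variable (E : PlaneCoordinates q L H)

/-- The value of the twisted form at the `i`-th basis vector and the basis vector outside `L`. -/
def coeff (i : Fin 3) : k :=
  alt (E.toMap (Pi.single i 1)) (frob q (E.toMap (Pi.single 2 1)))

/-- The equation of the fiber in coordinates on the plane. -/
def equation : MvPolynomial (Fin 3) k :=
  X 1 ^ q + X 2 ^ (q - 1) * (C (E.coeff 0) * X 0 + C (E.coeff 1) * X 1 + C (E.coeff 2) * X 2)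

theorem toMap_eq_sum (y : Fin 3 → k) : E.toMap y =
    y 0 • E.toMap (Pi.single 0 1) + y 1 • E.toMap (Pi.single 1 1) +
      y 2 • E.toMap (Pi.single 2 1) := by
  have h : y = y 0 • Pi.single 0 1 + y 1 • Pi.single 1 1 + y 2 • Pi.single 2 1 := by
    ext i
    fin_cases i <;> simp
  conv_lhs => rw [h]
  simp only [map_add, map_smul]

theorem mem_line_iff {y : Fin 3 → k} : E.toMap y ∈ L ↔ y 2 = 0 := by
  have h : E.toMap y ∈ (hyperplane 2 0 0).map E.toMap ↔ y ∈ hyperplane 2 0 0 :=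
    E.injective.mem_set_image
  rwa [E.map_eq, mem_hyperplane, zero_mul] at h

theorem toMap_mem (y : Fin 3 → k) : E.toMap y ∈ H := E.range_eq.le ⟨y, rfl⟩

theorem exists_of_mem {x : Fin 4 → k} (hx : x ∈ H) : ∃ y, E.toMap y = x := by
  rw [← E.range_eq] at hx
  exact hx

theorem alt_toMap_frob [Infinite k] (hq : IsFrobeniusPower k q) (hL : IsLineOnSurface q L)
    (y z : Fin 3 → k) : alt (E.toMap y) (frob q (E.toMap z)) =
      y 2 * z 1 ^ q + z 2 ^ q * (E.coeff 0 * y 0 + E.coeff 1 * y 1 + E.coeff 2 * y 2) := by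
  have h0 : E.toMap (Pi.single 0 1) ∈ L := E.mem_line_iff.mpr (by simp)
  have h1 : E.toMap (Pi.single 1 1) ∈ L := E.mem_line_iff.mpr (by simp)
  rw [E.toMap_eq_sum y, E.toMap_eq_sum z]
  simp only [hq.frob_add, frob_smul, map_add, map_smul, LinearMap.add_apply,
    LinearMap.smul_apply, smul_eq_mul, E.polar _ (E.toMap_mem _), E.pairing,
    hq.alt_frob_eq_zero hL h0 h1, hq.alt_frob_eq_zero hL h1 h1]
  simp only [coeff]
  ring

theorem subst_surfaceForm [Infinite k] (hq : IsFrobeniusPower k q) (hL : IsLineOnSurface q L) :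
    subst E.toMap (surfaceForm k q) = X 2 * E.equation := by
  refine MvPolynomial.funext fun y => ?_
  rw [eval_subst, eval_surfaceForm, E.alt_toMap_frob hq hL]
  simp only [equation, map_mul, map_add, map_pow, eval_X, eval_C]
  obtain ⟨n, rfl⟩ := Nat.exists_eq_succ_of_ne_zero hq.ne_zero
  simp only [Nat.succ_sub_one, Nat.succ_eq_add_one]
  ring

theorem fiberIdeal_eq [Infinite k] (hq : IsFrobeniusPower k q) (hL : IsLineOnSurface q L) :
    fiberIdeal q L H = (Ideal.span {E.equation}).comap (subst E.toMap) :=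
  fiberIdeal_eq_comap E.injective E.range_eq E.map_eq (E.subst_surfaceForm hq hL)

theorem coord_eq_zero_of_le_tangentPlane [Infinite k] (hq : IsFrobeniusPower k q)
    (hL : IsLineOnSurface q L) {y : Fin 3 → k} (hy : y 2 = 0)
    (h : H ≤ tangentPlane q (E.toMap y)) : y 1 = 0 := by
  have := h (E.toMap_mem (Pi.single 2 1))
  rw [mem_tangentPlane, E.alt_toMap_frob hq hL, hy] at this
  simpa [hq.ne_zero] using this

/-- If the coefficient of `X 0` in the equation of the fiber does not vanish, coordinates can be
chosen in which the equation is `X 1 ^ q = X 0 * X 2 ^ (q - 1)`. -/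
theorem exists_equation_eq [IsAlgClosed k] (hq : IsFrobeniusPower k q)
    (hL : IsLineOnSurface q L) (hH : H ∈ pencil L) (hE : E.coeff 0 ≠ 0) :
    ∃ E' : PlaneCoordinates q L H, E'.equation = X 1 ^ q - X 2 ^ (q - 1) * X 0 := by
  have hinv : -(E.coeff 0)⁻¹ ≠ 0 := by simpa using hE
  have hpol : ∀ (c : k), ∀ h ∈ H, alt h (frob q (c • E.toMap (Pi.single 0 1))) = 0 := by
    intro c h hh
    rw [frob_smul, map_smul, E.polar h hh, smul_zero]
  -- The basis vectors are changed by multiples of the point of tangency, which is isotropic.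
  obtain ⟨E', hE'⟩ := exists_planeCoordinates (q := q) hq hL hH
    (u := E.toMap (Pi.single 0 (-(E.coeff 0)⁻¹)))
    (v := E.toMap (Pi.single 1 1 + Pi.single 0 (-(E.coeff 1 / E.coeff 0))))
    (w := E.toMap (Pi.single 2 1 + Pi.single 0 (-(E.coeff 2 / E.coeff 0))))
    (E.mem_line_iff.mpr (by simp)) (E.mem_line_iff.mpr (by simp)) (E.toMap_mem _)
    (by
      rw [Ne, ← E.toMap.map_zero, E.injective.eq_iff]
      exact fun h => hinv (by simpa using congrFun h 0))
    (by
      intro h hh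
      have : (Pi.single 0 (-(E.coeff 0)⁻¹) : Fin 3 → k) =
          (-(E.coeff 0)⁻¹) • Pi.single 0 1 := by
        ext i
        fin_cases i <;> simp
      rw [this, map_smul]
      exact hpol _ h hh)
    (by
      rw [E.alt_toMap_frob hq hL]
      simp [hq.ne_zero])
  have hc0 : E'.coeff 0 = -1 := by
    rw [coeff, hE', combination_apply, combination_apply]
    simp only [Pi.single_eq_same, ne_eq, Fin.reduceEq, not_false_eq_true, Pi.single_eq_of_ne,
      zero_smul, one_smul, add_zero, zero_add]
    rw [E.alt_toMap_frob hq hL]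
    simp [hE]
  have hc1 : E'.coeff 1 = 0 := by
    rw [coeff, hE', combination_apply, combination_apply]
    simp only [Pi.single_eq_same, ne_eq, Fin.reduceEq, not_false_eq_true, Pi.single_eq_of_ne,
      zero_smul, one_smul, add_zero, zero_add]
    rw [E.alt_toMap_frob hq hL]
    simp [hq.ne_zero]
    field_simp
    ring
  have hc2 : E'.coeff 2 = 0 := by
    rw [coeff, hE', combination_apply]
    simp only [Pi.single_eq_same, ne_eq, Fin.reduceEq, not_false_eq_true, Pi.single_eq_of_ne,
      zero_smul, one_smul, add_zero, zero_add]
    rw [E.alt_toMap_frob hq hL]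
    simp [hq.ne_zero]
    field_simp
    ring
  refine ⟨E', ?_⟩
  rw [equation, hc0, hc1, hc2]
  simp [sub_eq_add_neg]

/-- The coefficient of `X 0` in the equation of the fiber vanishes if and only if the point of
tangency is fixed by the square of the Frobenius map. -/
theorem coeff_zero_eq_zero_iff [IsAlgClosed k] (hq : IsFrobeniusPower k q)
    (hL : IsLineOnSurface q L) (hH : H ∈ pencil L) :
    E.coeff 0 = 0 ↔ ∃ c : k, frob q (frob q (E.toMap (Pi.single 0 1))) =
      c • E.toMap (Pi.single 0 1) := by
  set u := E.toMap (Pi.single 0 1) with hu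
  have hu0 : u ≠ 0 := by
    rw [hu, Ne, ← E.toMap.map_zero, E.injective.eq_iff]
    exact fun h => one_ne_zero (α := k) (by simpa using congrFun h 0)
  have hz0 : frob q (frob q u) ≠ 0 := mt (fun h => hq.frob_eq_zero.mp (hq.frob_eq_zero.mp h)) hu0
  have hHu : H = tangentPlane q u := Submodule.eq_of_le_of_finrank_eq E.polar
    (by rw [hH.1, hq.finrank_tangentPlane hu0])
  constructor
  · intro h0
    -- The Frobenius twist of `H` is the orthogonal complement of the twice twisted point, and it
    -- is orthogonal to the point itself.
    have hle : LinearMap.ker (alt.flip (frob q (frob q u))) ≤ LinearMap.ker (alt.flip u) := by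
      intro t ht
      obtain ⟨h, rfl⟩ := hq.frob_surjective t
      have hh : h ∈ H := by
        have : alt (frob q h) (frob q (frob q u)) = 0 := ht
        rw [hq.alt_frob_frob, pow_eq_zero_iff hq.ne_zero] at this
        rw [hHu]
        exact this
      obtain ⟨y, rfl⟩ := E.exists_of_mem hh
      refine alt_isRefl _ _ ?_
      rw [hu, E.alt_toMap_frob hq hL, h0]
      simp
    have heq := Submodule.eq_of_le_of_finrank_eq hle
      (by rw [finrank_ker_alt_flip hz0, finrank_ker_alt_flip hu0])
    rw [← orthogonal_span_singleton, ← orthogonal_span_singleton] at heq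
    have heq' := congrArg alt.orthogonal heq
    rw [LinearMap.BilinForm.orthogonal_orthogonal alt_nondegenerate alt_isRefl,
      LinearMap.BilinForm.orthogonal_orthogonal alt_nondegenerate alt_isRefl] at heq'
    have hmem : frob q (frob q u) ∈ k ∙ u := heq' ▸ Submodule.mem_span_singleton_self _
    obtain ⟨c, hc⟩ := Submodule.mem_span_singleton.mp hmem
    exact ⟨c, hc.symm⟩
  · rintro ⟨c, hc⟩
    have hc0 : c ≠ 0 := by
      rintro rfl
      exact hz0 (by rw [hc, zero_smul])
    have h1 : c * E.coeff 0 = 0 := by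
      have h2 : alt (c • u) (frob q (E.toMap (Pi.single 2 1))) = 0 := by
        rw [← hc, hq.alt_frob_frob, alt_swap, E.polar _ (E.toMap_mem _), neg_zero,
          zero_pow hq.ne_zero]
      rwa [map_smul, LinearMap.smul_apply, smul_eq_mul] at h2
    exact (mul_eq_zero.mp h1).resolve_left hc0

end PlaneCoordinates

end Coordinates

section Fibers

variable {k : Type*} [Field k] {q : ℕ} {L H : Submodule k (Fin 4 → k)}

/-! ### The points of the fibers -/

namespace PlaneCoordinates

theorem eval_equation (E : PlaneCoordinates q L H) (y : Fin 3 → k) :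
    eval y E.equation = y 1 ^ q +
      y 2 ^ (q - 1) * (E.coeff 0 * y 0 + E.coeff 1 * y 1 + E.coeff 2 * y 2) := by
  simp [equation]

theorem eq_tangentPlane [Infinite k] (E : PlaneCoordinates q L H) (hq : IsFrobeniusPower k q)
    (hL : IsLineOnSurface q L) (hH : H ∈ pencil L) {y : Fin 3 → k} (hy : E.toMap y ≠ 0)
    (h1 : y 1 = 0) (h2 : y 2 = 0) : H = tangentPlane q (E.toMap y) := by
  refine Submodule.eq_of_le_of_finrank_eq (fun h hh => ?_)
    (by rw [hH.1, hq.finrank_tangentPlane hy])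
  obtain ⟨z, rfl⟩ := E.exists_of_mem hh
  rw [mem_tangentPlane, E.alt_toMap_frob hq hL, h1, h2]
  simp [hq.ne_zero]

end PlaneCoordinates

theorem exists_planeCoordinates_of_mem_pencil [IsAlgClosed k] (hq : IsFrobeniusPower k q)
    (hL : IsLineOnSurface q L) (hH : H ∈ pencil L) : Nonempty (PlaneCoordinates q L H) := by
  obtain ⟨u, hu, hu0, rfl⟩ := hq.exists_eq_tangentPlane hL hH
  exact ⟨(exists_planeCoordinates_tangentPlane hq hL hu hu0).choose⟩

/-- The set of points of a fiber is the preimage of the corresponding plane. -/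
theorem onScheme_fiberIdeal_iff [IsAlgClosed k] (hq : IsFrobeniusPower k q)
    (hL : IsLineOnSurface q L) (hH : H ∈ pencil L) (P : ℙ k (Fin 4 → k)) :
    OnScheme (fiberIdeal q L H) P ↔
      OnScheme (surfaceIdeal k q) P ∧ pencilMap q L P = H := by
  obtain ⟨E⟩ := exists_planeCoordinates_of_mem_pencil hq hL hH
  have hF : ∀ y, alt (E.toMap y) (frob q (E.toMap y)) = y 2 * eval y E.equation := by
    intro y
    rw [← eval_surfaceForm, ← eval_subst, E.subst_surfaceForm hq hL, map_mul, eval_X]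
  rw [E.fiberIdeal_eq hq hL, onScheme_comap_iff E.injective, onScheme_surfaceIdeal_iff]
  constructor
  · rintro ⟨y, hy, hG⟩
    refine ⟨by rw [← hy, hF, hG, mul_zero], ?_⟩
    by_cases h2 : y 2 = 0
    · have h1 : y 1 = 0 := by
        rw [E.eval_equation, h2, zero_pow (by have := hq.two_le; omega)] at hG
        simpa [hq.ne_zero] using hG
      rw [pencilMap_of_mem hq hL (hy ▸ E.mem_line_iff.mpr h2), ← hy,
        ← E.eq_tangentPlane hq hL hH (hy ▸ P.rep_nonzero) h1 h2]
    · have hP : P.rep ∉ L := by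
        rw [← hy, E.mem_line_iff]
        exact h2
      rw [pencilMap_of_notMem hP]
      refine Submodule.eq_of_le_of_finrank_eq (sup_le hH.2 ?_) ?_
      · rw [Submodule.span_singleton_le_iff_mem, ← hy]
        exact E.toMap_mem y
      · rw [hH.1, (sup_span_singleton_mem_pencil hL.1 hP).1]
  · rintro ⟨hS, hP⟩
    by_cases hPL : P.rep ∈ L
    · obtain ⟨y, hy⟩ := E.exists_of_mem (hH.2 hPL)
      have h2 : y 2 = 0 := E.mem_line_iff.mp (hy ▸ hPL)
      have h1 : y 1 = 0 := by
        refine E.coord_eq_zero_of_le_tangentPlane hq hL h2 ?_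
        rw [hy, ← pencilMap_of_mem hq hL hPL, hP]
      refine ⟨y, hy, ?_⟩
      rw [E.eval_equation, h1, h2, zero_pow hq.ne_zero,
        zero_pow (by have := hq.two_le; omega)]
      ring
    · rw [pencilMap_of_notMem hPL] at hP
      obtain ⟨y, hy⟩ := E.exists_of_mem
        (hP.le (Submodule.mem_sup_right (Submodule.mem_span_singleton_self P.rep)))
      refine ⟨y, hy, ?_⟩
      have h2 : y 2 ≠ 0 := fun h => hPL (hy ▸ E.mem_line_iff.mpr h)
      rw [← hy, hF] at hS
      exact (mul_eq_zero.mp hS).resolve_left h2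

/-! ### The integral fibers -/

section Cuspidal

/-- The equation `y₁ ^ q = y₀ y₂ ^ (q - 1)` of the integral fibers. -/
def cuspidalEquation (k : Type*) [Field k] (q : ℕ) : MvPolynomial (Fin 3) k :=
  X 1 ^ q - X 2 ^ (q - 1) * X 0

theorem eval_cuspidalEquation (y : Fin 3 → k) :
    eval y (cuspidalEquation k q) = y 1 ^ q - y 2 ^ (q - 1) * y 0 := by
  simp [cuspidalEquation]

theorem prime_cuspidalEquation (k : Type*) [Field k] (q : ℕ) : Prime (cuspidalEquation k q) := by
  -- The equation is linear in `X 0`, with coprime coefficients.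
  have hrel : IsRelPrime (-(X 2 ^ (q - 1)) : MvPolynomial (Fin 3) k) (X 1 ^ q) := by
    refine IsRelPrime.neg_left (IsRelPrime.pow ?_)
    rw [X_prime.irreducible.isRelPrime_iff_not_dvd, X_dvd_X]
    decide
  have hirr := irreducible_mul_X_add (-(X 2 ^ (q - 1)) : MvPolynomial (Fin 3) k) (X 1 ^ q) 0
    (neg_ne_zero.mpr (pow_ne_zero _ (X_ne_zero 2)))
    (by
      rw [vars_neg]
      intro h
      simpa [vars_X] using vars_pow _ _ h)
    (by
      intro h
      simpa [vars_X] using vars_pow _ _ h) hrel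
  have heq : cuspidalEquation k q = -(X 2 ^ (q - 1)) * X 0 + X 1 ^ q := by
    rw [cuspidalEquation]
    ring
  rw [heq]
  exact hirr.prime

theorem isPrime_comap_cuspidalEquation {n : ℕ} (T : (Fin 3 → k) →ₗ[k] (Fin n → k)) :
    ((Ideal.span {cuspidalEquation k q}).comap (subst T)).IsPrime := by
  have := Ideal.isPrime_span_singleton_of_prime (prime_cuspidalEquation k q)
  exact Ideal.comap_isPrime _ _

/-- The function field of the cuspidal curve is generated by the ratio `y₁ / y₂` of coordinates. -/
theorem isRationalCurve_comap_cuspidalEquation [IsAlgClosed k]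
    {T : (Fin 3 → k) →ₗ[k] (Fin 4 → k)} (hT : Function.Injective T) (hq : q ≠ 0) :
    IsRationalCurve ((Ideal.span {cuspidalEquation k q}).comap (subst T)) := by
  classical
  set I := (Ideal.span {cuspidalEquation k q}).comap (subst T) with hI
  have hprime : I.IsPrime := isPrime_comap_cuspidalEquation T
  refine ⟨hprime, ?_⟩
  obtain ⟨U, hU⟩ := T.exists_leftInverse_of_injective (LinearMap.ker_eq_bot.mpr hT)
  have hUsubst : ∀ h, subst T (subst U h) = h := fun h => MvPolynomial.funext fun y => by
    rw [eval_subst, eval_subst, ← LinearMap.comp_apply, hU, LinearMap.id_apply]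
  let K := FractionRing (MvPolynomial (Fin 4) k ⧸ I)
  let φ : MvPolynomial (Fin 4) k →ₐ[k] K :=
    (IsScalarTower.toAlgHom k (MvPolynomial (Fin 4) k ⧸ I) K).comp (Ideal.Quotient.mkₐ k I)
  have hφ0 : ∀ g, φ g = 0 ↔ g ∈ I := by
    intro g
    rw [← Ideal.Quotient.eq_zero_iff_mem]
    exact map_eq_zero_iff (algebraMap (MvPolynomial (Fin 4) k ⧸ I) K)
      (IsFractionRing.injective _ _)
  let ψ : MvPolynomial (Fin 3) k →ₐ[k] K := φ.comp (subst U)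
  have hψ0 : ∀ h, ψ h = 0 ↔ cuspidalEquation k q ∣ h := by
    intro h
    rw [AlgHom.comp_apply, hφ0, hI, Ideal.mem_comap, hUsubst, Ideal.mem_span_singleton]
  have hφψ : ∀ g, φ g = ψ (subst T g) := by
    intro g
    change φ g = φ (subst U (subst T g))
    rw [← sub_eq_zero, ← map_sub, hφ0, hI, Ideal.mem_comap, map_sub, hUsubst,
      sub_self]
    exact Ideal.zero_mem _
  have hc0 : ψ (X 2) ≠ 0 := by
    rw [Ne, hψ0]
    rintro ⟨m, hm⟩
    have := congrArg (eval fun _ => (1 : k)) hm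
    rw [map_mul, eval_cuspidalEquation] at this
    simp at this
  have hrel : ψ (X 1) ^ q = ψ (X 2) ^ (q - 1) * ψ (X 0) := by
    have := (hψ0 (cuspidalEquation k q)).mpr dvd_rfl
    rw [cuspidalEquation, map_sub, map_pow, map_mul, map_pow] at this
    exact sub_eq_zero.mp this
  set t : K := ψ (X 1) / ψ (X 2) with ht
  have h1 : ψ (X 1) = ψ (X 2) * t := by rw [ht, mul_div_cancel₀ _ hc0]
  have h0 : ψ (X 0) = ψ (X 2) * t ^ q := by
    obtain ⟨n, rfl⟩ := Nat.exists_eq_succ_of_ne_zero hq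
    rw [h1, Nat.succ_sub_one] at hrel
    refine mul_left_cancel₀ (pow_ne_zero n hc0) ?_
    rw [← hrel, mul_pow, pow_succ (ψ (X 2)), mul_assoc]
  have hx : ∀ i, ∃ z ∈ IntermediateField.adjoin k {t}, φ (X i) = ψ (X 2) * z := by
    intro i
    have htm : t ∈ IntermediateField.adjoin k {t} := IntermediateField.mem_adjoin_simple_self k t
    refine ⟨algebraMap k K (T (Pi.single 0 1) i) * t ^ q +
      algebraMap k K (T (Pi.single 1 1) i) * t + algebraMap k K (T (Pi.single 2 1) i), ?_, ?_⟩
    · exact add_mem (add_mem (mul_mem (IntermediateField.algebraMap_mem _ _) (pow_mem htm q))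
        (mul_mem (IntermediateField.algebraMap_mem _ _) htm))
        (IntermediateField.algebraMap_mem _ _)
    · rw [hφψ, subst, aeval_X, linearForm]
      simp only [Fin.sum_univ_three, map_add, map_mul, LinearMap.comp_apply,
        LinearMap.proj_apply]
      have hC : ∀ c : k, ψ (C c) = algebraMap k K c := fun c => ψ.commutes c
      rw [hC, hC, hC, h0, h1]
      ring
  have hle : functionField I ≤ IntermediateField.adjoin k {t} := by
    refine IntermediateField.adjoin_le_iff.mpr ?_
    rintro _ ⟨i, j, rfl⟩
    obtain ⟨z, hz, hzi⟩ := hx i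
    obtain ⟨w, hw, hwj⟩ := hx j
    change φ (X i) / φ (X j) ∈ _
    rw [hzi, hwj, mul_div_mul_left _ _ hc0]
    exact div_mem hz hw
  have hlin : ∀ (f : (Fin 4 → k) →ₗ[k] k),
      φ (linearForm f) = ∑ i, algebraMap k K (f (Pi.single i 1)) * φ (X i) := by
    intro f
    rw [linearForm, map_sum]
    refine Finset.sum_congr rfl fun i _ => ?_
    rw [map_mul]
    congr 1
  have hψX : ∀ j, ψ (X j) = φ (linearForm (LinearMap.proj j ∘ₗ U)) := by
    intro j
    rw [AlgHom.comp_apply, subst, aeval_X]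
  obtain ⟨l, hl⟩ : ∃ l, φ (X l) ≠ 0 := by
    by_contra! hcon
    exact hc0 (by rw [hψX, hlin]; simp [hcon])
  have hratio : ∀ j, ψ (X j) / φ (X l) ∈ functionField I := by
    intro j
    rw [hψX, hlin, Finset.sum_div]
    refine sum_mem fun i _ => ?_
    rw [mul_div_assoc]
    exact mul_mem (IntermediateField.algebraMap_mem _ _)
      (IntermediateField.subset_adjoin _ _ ⟨i, l, rfl⟩)
  have heq : functionField I = IntermediateField.adjoin k {t} := by
    refine le_antisymm hle (IntermediateField.adjoin_simple_le_iff.mpr ?_)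
    have := div_mem (hratio 1) (hratio 2)
    rwa [div_div_div_cancel_right₀ hl] at this
  have htr : Transcendental k t := by
    intro halg
    have hint := halg.isIntegral
    obtain ⟨r, hr⟩ := minpoly.mem_range_of_degree_eq_one k t
      (IsAlgClosed.degree_eq_one_of_irreducible k (minpoly.irreducible hint))
    have hzero : ψ (X 1 - C r * X 2) = 0 := by
      have hC : ψ (C r) = t := (ψ.commutes r).trans hr
      rw [map_sub, map_mul, hC, h1]
      ring
    rw [hψ0] at hzero
    obtain ⟨m, hm⟩ := hzero
    -- The point of the curve with `y₁ / y₂ = r + 1` is not on the line `y₁ = r y₂`.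
    have := congrArg (eval ![(r + 1) ^ q, r + 1, 1]) hm
    rw [map_mul, eval_cuspidalEquation] at this
    simp at this
  exact ⟨(IntermediateField.equivOfEq heq).trans (RatFunc.algEquivOfTranscendental t htr).symm⟩

theorem isSingularPoint_cuspidal_iff [Infinite k] {T : (Fin 3 → k) →ₗ[k] (Fin 4 → k)}
    (hT : Function.Injective T) (hq : IsFrobeniusPower k q) (P : ℙ k (Fin 4 → k)) :
    IsSingularPoint ((Ideal.span {cuspidalEquation k q}).comap (subst T)) P ↔
      q ≠ 2 ∧ ∃ c : k, c • T (Pi.single 0 1) = P.rep := by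
  have h2q := hq.two_le
  have hcast : ((q - 1 : ℕ) : k) = -1 := by
    rw [Nat.cast_sub (by omega), hq.cast_eq_zero, Nat.cast_one, zero_sub]
  have hd0 : ∀ y : Fin 3 → k, eval y (pderiv 0 (cuspidalEquation k q)) = -y 2 ^ (q - 1) := by
    intro y
    simp [cuspidalEquation, Derivation.leibniz, Derivation.leibniz_pow, pderiv_X]
  have hd1 : ∀ y : Fin 3 → k, eval y (pderiv 1 (cuspidalEquation k q)) = 0 := by
    intro y
    simp [cuspidalEquation, Derivation.leibniz, Derivation.leibniz_pow, pderiv_X,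
      hq.cast_eq_zero]
  have hd2 : ∀ y : Fin 3 → k,
      eval y (pderiv 2 (cuspidalEquation k q)) = y 0 * y 2 ^ (q - 1 - 1) := by
    intro y
    simp [cuspidalEquation, Derivation.leibniz, Derivation.leibniz_pow, pderiv_X, hcast]
  rw [isSingularPoint_comap_iff hT]
  constructor
  · rintro ⟨y, hy, hG, hd⟩
    have h2 : y 2 = 0 := by
      have := hd 0
      rw [hd0, neg_eq_zero] at this
      exact eq_zero_of_pow_eq_zero this
    have h1 : y 1 = 0 := by
      rw [eval_cuspidalEquation, h2, zero_pow (by omega), zero_mul, sub_zero] at hG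
      exact eq_zero_of_pow_eq_zero hG
    have hy0 : y = y 0 • Pi.single 0 1 := by
      ext i
      fin_cases i <;> simp [h1, h2]
    refine ⟨?_, y 0, by rw [← map_smul, ← hy0, hy]⟩
    rintro rfl
    have := hd 2
    rw [hd2] at this
    have h0 : y 0 = 0 := by simpa using this
    refine P.rep_nonzero ?_
    rw [← hy, hy0, h0, zero_smul, map_zero]
  · rintro ⟨hq2, c, hc⟩
    refine ⟨c • Pi.single 0 1, by rw [map_smul, hc], ?_, ?_⟩
    · rw [eval_cuspidalEquation]
      simp [hq.ne_zero, show q - 1 ≠ 0 by omega]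
    · intro j
      fin_cases j
      · exact (hd0 _).trans (by simp [show q - 1 ≠ 0 by omega])
      · exact hd1 _
      · exact (hd2 _).trans (by simp [show q - 1 - 1 ≠ 0 by omega])

theorem existsUnique_isSingularPoint_cuspidal [Infinite k] {T : (Fin 3 → k) →ₗ[k] (Fin 4 → k)}
    (hT : Function.Injective T) (hq : IsFrobeniusPower k q) (hq2 : q ≠ 2) :
    ∃! P, IsSingularPoint ((Ideal.span {cuspidalEquation k q}).comap (subst T)) P := by
  have hu0 : T (Pi.single 0 1) ≠ 0 := by
    rw [Ne, ← T.map_zero, hT.eq_iff]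
    exact fun h => one_ne_zero (α := k) (by simpa using congrFun h 0)
  refine ⟨Projectivization.mk k _ hu0, ?_, ?_⟩
  · refine (isSingularPoint_cuspidal_iff hT hq _).mpr ?_
    obtain ⟨c, hc⟩ := Projectivization.exists_smul_eq_mk_rep k _ hu0
    exact ⟨hq2, c, hc⟩
  · intro P hP
    obtain ⟨-, c, hc⟩ := (isSingularPoint_cuspidal_iff hT hq P).mp hP
    rw [← P.mk_rep, Projectivization.mk_eq_mk_iff']
    exact ⟨c, hc⟩

end Cuspidal

end Fibers

section Degenerate

variable {k : Type*} [Field k] {q : ℕ} {L H : Submodule k (Fin 4 → k)}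

/-! ### The degenerate fibers -/

theorem IsFrobeniusPower.frob_injective (hq : IsFrobeniusPower k q) :
    Function.Injective (frob (k := k) q) := by
  intro x y h
  have h1 := hq.frob_add (x - y) y
  rw [sub_add_cancel, h, right_eq_add, hq.frob_eq_zero, sub_eq_zero] at h1
  exact h1

/-- A separable additive polynomial with a constant added has `q` distinct roots. -/
theorem IsFrobeniusPower.exists_roots [IsAlgClosed k] (hq : IsFrobeniusPower k q) {b : k}
    (hb : b ≠ 0) (c : k) :
    ∃ s : Finset k, s.card = q ∧ ∀ x, ∏ r ∈ s, (x - r) = x ^ q + b * x + c := by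
  classical
  have h2q := hq.two_le
  let f : Polynomial k :=
    Polynomial.X ^ q + (Polynomial.C b * Polynomial.X + Polynomial.C c)
  have hlow : (Polynomial.C b * Polynomial.X + Polynomial.C c).degree < (q : WithBot ℕ) :=
    Polynomial.degree_linear_le.trans_lt (by exact_mod_cast h2q)
  have hmonic : f.Monic := Polynomial.monic_X_pow_add hlow
  have hdeg : f.natDegree = q := by
    refine Polynomial.natDegree_eq_of_degree_eq_some ?_
    rw [Polynomial.degree_add_eq_left_of_degree_lt, Polynomial.degree_X_pow]
    rwa [Polynomial.degree_X_pow]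
  have hsep : f.Separable := by
    have hder : f.derivative = Polynomial.C b := by
      simp [f, Polynomial.derivative_X_pow, hq.cast_eq_zero]
    rw [Polynomial.Separable, hder]
    exact ⟨0, Polynomial.C b⁻¹, by
      rw [zero_mul, zero_add, ← Polynomial.C_mul, inv_mul_cancel₀ hb, Polynomial.C_1]⟩
  have hsplits := IsAlgClosed.splits f
  have hnodup := Polynomial.nodup_roots hsep
  refine ⟨f.roots.toFinset, ?_, fun x => ?_⟩
  · rw [Multiset.toFinset_card_of_nodup hnodup, IsAlgClosed.card_roots_eq_natDegree, hdeg]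
  · have h := hsplits.eval_eq_prod_roots_of_monic hmonic x
    rw [Finset.prod, Multiset.toFinset_val, hnodup.dedup, ← h]
    simp [f, add_assoc]

theorem isRelPrime_X_sub_C_mul_X {σ : Type*} {i j : σ} (hij : i ≠ j) {r s : k} (hrs : r ≠ s) :
    IsRelPrime (X i - C r * X j : MvPolynomial σ k) (X i - C s * X j) := by
  intro d hr hs
  have hsr : s - r ≠ 0 := sub_ne_zero.mpr hrs.symm
  have hj : d ∣ X j := by
    have h := (dvd_sub hr hs).mul_left (C (s - r)⁻¹)
    have hc : (C (s - r)⁻¹ * (C s - C r) : MvPolynomial σ k) = 1 := by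
      rw [← C_sub, ← C_mul, inv_mul_cancel₀ hsr, C_1]
    have heq : C (s - r)⁻¹ * (X i - C r * X j - (X i - C s * X j)) = (X j : MvPolynomial σ k) := by
      linear_combination X j * hc
    rwa [heq] at h
  have hi : d ∣ X i := by
    have h := dvd_add hr (hj.mul_left (C r))
    rwa [sub_add_cancel] at h
  refine (X_prime.irreducible.isRelPrime_iff_not_dvd.mpr ?_ : IsRelPrime (X i) (X j)) hi hj
  rwa [X_dvd_X]

/-- The ideal of the union of two or more distinct lines is not prime. -/
theorem not_isPrime_iInf_linearIdeal {s : Finset (Submodule k (Fin 4 → k))} (hs : 1 < s.card)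
    (h2 : ∀ M ∈ s, Module.finrank k M = 2) : ¬ (⨅ M ∈ s, linearIdeal M).IsPrime := by
  intro h
  rw [← Finset.inf_eq_iInf] at h
  obtain ⟨M, hM, hle⟩ := (Ideal.IsPrime.inf_le' h).mp le_rfl
  obtain ⟨N, hN, hne⟩ := Finset.exists_mem_ne hs M
  have hNM : N ≤ M := linearIdeal_le_iff.mp (hle.trans (Finset.inf_le hN))
  exact hne (Submodule.eq_of_le_of_finrank_eq hNM (by rw [h2 N hN, h2 M hM]))

/-- A fiber whose equation does not involve `X 0` is the reduced union of `q` lines. -/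
theorem PlaneCoordinates.exists_lines [IsAlgClosed k] (E : PlaneCoordinates q L H)
    (hq : IsFrobeniusPower k q) (hL : IsLineOnSurface q L) (hH : H ∈ pencil L)
    (hE : E.coeff 0 = 0) :
    ∃ (lines : Finset (Submodule k (Fin 4 → k))) (P : ℙ k (Fin 4 → k)),
      lines.card = q ∧
      (∀ M ∈ lines, IsLineOnSurface q M ∧ P.submodule ≤ M) ∧
      fiberIdeal q L H = ⨅ M ∈ lines, linearIdeal M ∧
      (∀ M ∈ lines, ∀ N ∈ lines, M ≠ N → MeetTransverselyAt q M N P) := by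
  classical
  have h2q := hq.two_le
  have h12 : (1 : Fin 3) ≠ 2 := by decide
  -- If both coefficients vanished, the last basis vector would belong to the line `L`.
  have hE1 : E.coeff 1 ≠ 0 := by
    intro hE1
    obtain ⟨u, hu, huw⟩ := hq.exists_frob_eq hL (v := frob q (E.toMap (Pi.single 2 1))) (by
      intro x hx
      obtain ⟨y, rfl⟩ := E.exists_of_mem (hH.2 hx)
      rw [E.alt_toMap_frob hq hL, hE, hE1, E.mem_line_iff.mp hx]
      simp)
    rw [hq.frob_injective huw, E.mem_line_iff, Pi.single_eq_same] at hu
    exact one_ne_zero hu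
  obtain ⟨s, hscard, hs⟩ := hq.exists_roots hE1 (E.coeff 2)
  have hprod : E.equation = ∏ r ∈ s, (X 1 - C r * X 2) := by
    refine MvPolynomial.funext fun y => ?_
    rw [E.eval_equation, hE, map_prod]
    simp only [map_sub, map_mul, eval_X, eval_C]
    by_cases h2 : y 2 = 0
    · simp [h2, Finset.prod_const, hscard, show q - 1 ≠ 0 by omega]
    · obtain ⟨z, hz⟩ : ∃ z, y 1 = y 2 * z := ⟨y 1 / y 2, by field_simp⟩
      have h : ∏ r ∈ s, (y 1 - r * y 2) = y 2 ^ q * ∏ r ∈ s, (z - r) := by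
        rw [← hscard, ← Finset.prod_const, ← Finset.prod_mul_distrib, hz]
        exact Finset.prod_congr rfl fun r _ => by ring
      rw [h, hs, hz]
      obtain ⟨n, rfl⟩ := Nat.exists_eq_succ_of_ne_zero hq.ne_zero
      simp only [Nat.succ_sub_one, Nat.succ_eq_add_one]
      ring
  let line : k → Submodule k (Fin 4 → k) := fun r => (hyperplane 1 2 r).map E.toMap
  have hmem : ∀ r y, E.toMap y ∈ line r ↔ y 1 = r * y 2 := fun r y => by
    rw [← mem_hyperplane]
    exact E.injective.mem_set_image
  have hline : ∀ r, ∀ x ∈ line r, ∃ y, E.toMap y = x ∧ y 1 = r * y 2 := by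
    rintro r _ ⟨y, hy, rfl⟩
    exact ⟨y, rfl, mem_hyperplane.mp hy⟩
  have hrank : ∀ r, Module.finrank k (line r) = 2 := fun r => by
    have h : Module.finrank k (line r) + 1 = 3 := finrank_map_hyperplane E.injective h12 r
    omega
  have hinj : Function.Injective line := by
    intro r t hrt
    have h1 : E.toMap ![0, r, 1] ∈ line r := (hmem _ _).mpr (by simp)
    rw [hrt, hmem] at h1
    simpa using h1
  have hu0 : E.toMap (Pi.single 0 1) ≠ 0 := by
    rw [Ne, ← E.toMap.map_zero, E.injective.eq_iff]
    exact fun h => one_ne_zero (α := k) (by simpa using congrFun h 0)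
  have hsub : (Projectivization.mk k _ hu0).submodule = k ∙ E.toMap (Pi.single 0 1) :=
    Projectivization.submodule_mk _ hu0
  have hPle : ∀ r, (Projectivization.mk k _ hu0).submodule ≤ line r := by
    intro r
    rw [hsub, Submodule.span_singleton_le_iff_mem, hmem]
    simp
  refine ⟨s.image line, Projectivization.mk k _ hu0, ?_, ?_, ?_, ?_⟩
  · rw [Finset.card_image_of_injective _ hinj, hscard]
  · intro M hM
    obtain ⟨r, hr, rfl⟩ := Finset.mem_image.mp hM
    refine ⟨⟨hrank r, fun x hx => ?_⟩, hPle r⟩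
    obtain ⟨y, rfl, hy⟩ := hline r x hx
    rw [← eval_subst, E.subst_surfaceForm hq hL, map_mul, hprod, map_prod,
      Finset.prod_eq_zero hr (by simp [hy]), mul_zero]
  · ext g
    rw [E.fiberIdeal_eq hq hL, Ideal.mem_comap, Ideal.mem_span_singleton, hprod]
    simp only [Submodule.mem_iInf, Finset.forall_mem_image, line,
      linearIdeal_map_hyperplane E.toMap h12, Ideal.mem_comap, Ideal.mem_span_singleton]
    constructor
    · intro h r hr
      exact (Finset.dvd_prod_of_mem
        (fun r => (X 1 - C r * X 2 : MvPolynomial (Fin 3) k)) hr).trans h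
    · intro h
      refine Finset.prod_dvd_of_isRelPrime (fun r _ t _ hrt => ?_) fun r hr => h hr
      exact isRelPrime_X_sub_C_mul_X h12 hrt
  · intro M hM N hN hMN
    obtain ⟨r, hr, rfl⟩ := Finset.mem_image.mp hM
    obtain ⟨t, ht, rfl⟩ := Finset.mem_image.mp hN
    have hrt : r ≠ t := fun h => hMN (by rw [h])
    have hinf : line r ⊓ line t = (Projectivization.mk k _ hu0).submodule := by
      refine le_antisymm ?_ (le_inf (hPle r) (hPle t))
      rintro x ⟨hx, hx'⟩
      obtain ⟨y, rfl, hy⟩ := hline r x hx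
      have hy' := (hmem t y).mp hx'
      have h2 : y 2 = 0 := by
        rw [hy] at hy'
        by_contra h
        exact hrt (mul_right_cancel₀ h hy')
      rw [h2, mul_zero] at hy
      rw [hsub, Submodule.mem_span_singleton]
      refine ⟨y 0, ?_⟩
      rw [E.toMap_eq_sum y, hy, h2]
      simp
    refine ⟨hinf, ?_⟩
    obtain ⟨c, hc⟩ := Projectivization.exists_smul_eq_mk_rep k _ hu0
    have hrep : (Projectivization.mk k _ hu0).rep ∈ L := by
      rw [← hc]
      exact L.smul_mem _ (E.mem_line_iff.mpr (by simp))
    rw [hq.tangentSpace_surfaceIdeal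
      (onScheme_surfaceIdeal_iff.mpr (hq.alt_frob_eq_zero hL hrep hrep)), ← hc,
      Units.smul_def, tangentPlane_smul c.ne_zero,
      ← E.eq_tangentPlane hq hL hH hu0 (by simp) (by simp)]
    refine Submodule.eq_of_le_of_finrank_eq (sup_le ?_ ?_) ?_
    · exact fun x hx => by
        obtain ⟨y, rfl, -⟩ := hline r x hx
        exact E.toMap_mem y
    · exact fun x hx => by
        obtain ⟨y, rfl, -⟩ := hline t x hx
        exact E.toMap_mem y
    · have h := Submodule.finrank_sup_add_finrank_inf_eq (line r) (line t)
      rw [hinf, Projectivization.finrank_submodule, hrank, hrank] at h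
      rw [hH.1]
      omega

theorem PlaneCoordinates.mem_singularFibers_iff [IsAlgClosed k] (E : PlaneCoordinates q L H)
    (hq : IsFrobeniusPower k q) (hL : IsLineOnSurface q L) (hH : H ∈ pencil L) :
    H ∈ singularFibers q L ↔ E.coeff 0 = 0 := by
  constructor
  · rintro ⟨-, hnot⟩
    by_contra hE
    obtain ⟨E', hE'⟩ := E.exists_equation_eq hq hL hH hE
    refine hnot ?_
    rw [E'.fiberIdeal_eq hq hL, hE']
    exact isPrime_comap_cuspidalEquation _
  · intro hE
    obtain ⟨lines, P, hcard, hlines, heq, -⟩ := E.exists_lines hq hL hH hE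
    refine ⟨hH, ?_⟩
    rw [heq]
    exact not_isPrime_iInf_linearIdeal (hcard ▸ hq.two_le) fun M hM => (hlines M hM).1.1

/-! ### The number of degenerate fibers -/

/-- The plane tangent to the surface at a point of the line carries a degenerate fiber if and only
if the point is rational over the field with `q ^ 2` elements up to a scalar. -/
theorem tangentPlane_mem_singularFibers_iff [IsAlgClosed k] (hq : IsFrobeniusPower k q)
    (hL : IsLineOnSurface q L) {u : Fin 4 → k} (hu : u ∈ L) (hu0 : u ≠ 0) :
    tangentPlane q u ∈ singularFibers q L ↔ ∃ c : k, frob q (frob q u) = c • u := by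
  obtain ⟨E, hE⟩ := exists_planeCoordinates_tangentPlane hq hL hu hu0
  have hH := hq.tangentPlane_mem_pencil hL hu hu0
  rw [E.mem_singularFibers_iff hq hL hH, E.coeff_zero_eq_zero_iff hq hL hH, hE]

theorem exists_eq_smul_of_tangentPlane_eq [IsAlgClosed k] (hq : IsFrobeniusPower k q)
    (hL : IsLineOnSurface q L) {u v : Fin 4 → k} (hu : u ∈ L) (hu0 : u ≠ 0) (hv : v ∈ L)
    (h : tangentPlane q u = tangentPlane q v) : ∃ c : k, v = c • u := by
  obtain ⟨E, hE⟩ := exists_planeCoordinates_tangentPlane hq hL hu hu0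
  obtain ⟨y, rfl⟩ := E.exists_of_mem ((hq.tangentPlane_mem_pencil hL hu hu0).2 hv)
  have h2 := E.mem_line_iff.mp hv
  have h1 := E.coord_eq_zero_of_le_tangentPlane hq hL h2 h.le
  exact ⟨y 0, by rw [E.toMap_eq_sum y, h1, h2, hE]; simp⟩

/-- A line on the surface is defined over the field with `q ^ 2` elements: it has a basis of
vectors fixed by the square of the Frobenius map. -/
theorem exists_fixed_basis [IsAlgClosed k] (hq : IsFrobeniusPower k q)
    (hL : IsLineOnSurface q L) :
    ∃ (i j : Fin 4), ∃ x ∈ L, ∃ y ∈ L, x i = 1 ∧ x j = 0 ∧ y i = 0 ∧ y j = 1 ∧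
      frob q (frob q x) = x ∧ frob q (frob q y) = y ∧ ∀ z ∈ L, z = z i • x + z j • y := by
  -- The basis in reduced echelon form is fixed because the line is stable.
  have hstable : ∀ z ∈ L, frob q (frob q z) ∈ L := fun z hz =>
    hq.mem_line_of_forall hL fun w hw => by
      rw [hq.alt_frob_frob, alt_swap, hq.alt_frob_eq_zero hL hw hz, neg_zero,
        zero_pow hq.ne_zero]
  obtain ⟨v, hv, w, hw, hvw⟩ := exists_basis_of_finrank_eq_two hL.1
  have hv0 : v ≠ 0 := hvw.ne_zero 0
  obtain ⟨i, hi⟩ : ∃ i, v i ≠ 0 := by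
    by_contra! hcon
    exact hv0 (funext hcon)
  have hy0 : v i • w - w i • v ≠ 0 := by
    intro h
    have := LinearIndependent.pair_iff.mp hvw (-w i) (v i) (by rw [← h, neg_smul]; abel)
    exact hi this.2
  obtain ⟨j, hj⟩ : ∃ j, (v i • w - w i • v) j ≠ 0 := by
    by_contra! hcon
    exact hy0 (funext hcon)
  obtain ⟨y, hy, hyi, hyj⟩ : ∃ y ∈ L, y i = 0 ∧ y j = 1 :=
    ⟨((v i • w - w i • v) j)⁻¹ • (v i • w - w i • v),
      L.smul_mem _ (L.sub_mem (L.smul_mem _ hw) (L.smul_mem _ hv)), by simp [mul_comm],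
      inv_mul_cancel₀ hj⟩
  obtain ⟨x, hx, hxi, hxj⟩ : ∃ x ∈ L, x i = 1 ∧ x j = 0 :=
    ⟨(v i)⁻¹ • v - ((v i)⁻¹ * v j) • y, L.sub_mem (L.smul_mem _ hv) (L.smul_mem _ hy),
      by simp [hyi, hi], by simp [hyj]⟩
  have hspan : Submodule.span k {x, y} = L := by
    refine Submodule.eq_of_le_of_finrank_eq ?_ ?_
    · rw [Submodule.span_le]
      rintro _ (rfl | rfl) <;> assumption
    · rw [hL.1, finrank_span_pair]
      rw [LinearIndependent.pair_iff]
      intro a b hab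
      exact ⟨by simpa [hxi, hyi] using congrFun hab i, by simpa [hxj, hyj] using congrFun hab j⟩
  have hcoord : ∀ z ∈ L, z = z i • x + z j • y := by
    intro z hz
    rw [← hspan] at hz
    obtain ⟨a, b, rfl⟩ := Submodule.mem_span_pair.mp hz
    simp [hxi, hyi, hxj, hyj]
  refine ⟨i, j, x, hx, y, hy, hxi, hxj, hyi, hyj, ?_, ?_, hcoord⟩
  · rw [hcoord _ (hstable x hx)]
    simp [hxi, hxj, hq.ne_zero]
  · rw [hcoord _ (hstable y hy)]
    simp [hyi, hyj, hq.ne_zero]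

theorem IsFrobeniusPower.ncard_fixed [IsAlgClosed k] (hq : IsFrobeniusPower k q) :
    {t : k | t ^ q ^ 2 = t}.ncard = q ^ 2 := by
  have h2q := hq.two_le
  have hq2 : IsFrobeniusPower k (q ^ 2) :=
    ⟨h2q.trans (Nat.le_self_pow two_ne_zero q), by simp [hq.cast_eq_zero], fun x y => by
      simp only [sq, pow_mul, hq.add_pow]⟩
  obtain ⟨s, hs, hprod⟩ := hq2.exists_roots (b := (-1 : k)) (by simp) 0
  have : {t : k | t ^ q ^ 2 = t} = s := by
    ext t
    have h := hprod t
    rw [Set.mem_ofPred_eq, Finset.mem_coe, ← sub_eq_zero]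
    have h' : t ^ q ^ 2 - t = ∏ r ∈ s, (t - r) := by rw [h]; ring
    rw [h', Finset.prod_eq_zero_iff]
    constructor
    · rintro ⟨r, hr, hrt⟩
      rwa [sub_eq_zero.mp hrt]
    · exact fun ht => ⟨t, ht, sub_self t⟩
  rw [this, Set.ncard_coe_finset, hs]

theorem ncard_singularFibers [IsAlgClosed k] (hq : IsFrobeniusPower k q)
    (hL : IsLineOnSurface q L) : (singularFibers q L).ncard = q ^ 2 + 1 := by
  obtain ⟨i, j, x, hx, y, hy, hxi, hxj, hyi, hyj, hfx, hfy, hcoord⟩ := exists_fixed_basis hq hL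
  have hfrob : ∀ a b : k, frob q (frob q (a • x + b • y)) =
      a ^ q ^ 2 • x + b ^ q ^ 2 • y := by
    intro a b
    simp only [hq.frob_add, frob_smul, hfx, hfy, ← pow_mul, sq]
  have hxt0 : ∀ t : k, x + t • y ≠ 0 := fun t h => by
    simpa [hxi, hyi] using congrFun h i
  have hxtL : ∀ t : k, x + t • y ∈ L := fun t =>
    L.add_mem hx (L.smul_mem t hy)
  have hy0 : y ≠ 0 := fun h => by simpa [hyj] using congrFun h j
  have heq : singularFibers q L =
      insert (tangentPlane q y)
        ((fun t : k => tangentPlane q (x + t • y)) '' {t | t ^ q ^ 2 = t}) := by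
    ext H
    constructor
    · intro hH
      obtain ⟨u, hu, hu0, rfl⟩ := hq.exists_eq_tangentPlane hL hH.1
      rw [tangentPlane_mem_singularFibers_iff hq hL hu hu0] at hH
      obtain ⟨c, hc⟩ := hH
      obtain ⟨a, b, rfl⟩ : ∃ a b : k, u = a • x + b • y := ⟨_, _, hcoord u hu⟩
      rw [hfrob] at hc
      have ha : a ^ q ^ 2 = c * a := by simpa [hxi, hyi] using congrFun hc i
      have hb : b ^ q ^ 2 = c * b := by simpa [hxj, hyj] using congrFun hc j
      by_cases ha0 : a = 0
      · left
        rw [ha0, zero_smul, zero_add] at hu0 ⊢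
        exact tangentPlane_smul (fun h => hu0 (by rw [h, zero_smul])) y
      · right
        have hc0 : c ≠ 0 := by
          rintro rfl
          rw [zero_mul] at ha
          exact ha0 (eq_zero_of_pow_eq_zero ha)
        refine ⟨b / a, ?_, ?_⟩
        · rw [Set.mem_ofPred_eq, div_pow, ha, hb, mul_div_mul_left _ _ hc0]
        · dsimp only
          rw [← tangentPlane_smul ha0, smul_add, smul_smul, mul_div_cancel₀ _ ha0]
    · rintro (rfl | ⟨t, ht, rfl⟩)
      · rw [tangentPlane_mem_singularFibers_iff hq hL hy hy0]
        exact ⟨1, by rw [hfy, one_smul]⟩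
      · rw [tangentPlane_mem_singularFibers_iff hq hL (hxtL t) (hxt0 t)]
        refine ⟨1, ?_⟩
        have h := hfrob 1 t
        rw [one_smul, one_pow, one_smul, show t ^ q ^ 2 = t from ht] at h
        rw [h, one_smul]
  have hinj : Function.Injective fun t : k => tangentPlane q (x + t • y) := by
    intro s t hst
    obtain ⟨c, hc⟩ := exists_eq_smul_of_tangentPlane_eq hq hL (hxtL s) (hxt0 s) (hxtL t) hst
    have h1 : 1 = c := by simpa [hxi, hyi] using congrFun hc i
    have h2 : t = c * s := by simpa [hxj, hyj] using congrFun hc j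
    rw [h2, ← h1, one_mul]
  have hnot : tangentPlane q y ∉
      (fun t : k => tangentPlane q (x + t • y)) '' {t : k | t ^ q ^ 2 = t} := by
    rintro ⟨t, -, ht⟩
    obtain ⟨c, hc⟩ := exists_eq_smul_of_tangentPlane_eq hq hL hy hy0 (hxtL t) ht.symm
    simpa [hxi, hyi] using congrFun hc i
  have hcard := hq.ncard_fixed
  have hfinite : {t : k | t ^ q ^ 2 = t}.Finite :=
    Set.finite_of_ncard_pos (by rw [hcard]; exact pow_pos (by have := hq.two_le; omega) 2)
  rw [heq, Set.ncard_insert_of_notMem hnot (hfinite.image _), Set.ncard_image_of_injective _ hinj,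
    hcard]

end Degenerate

end HermitianPencil

end

theorem theorem4p3 {k : Type*} [Field k] [IsAlgClosed k] (p a q : ℕ) [Fact p.Prime] [CharP k p]
    (ha : 0 < a) (hq : q = p ^ a) (L : Submodule k (Fin 4 → k))
    (hL : HermitianPencil.IsLineOnSurface q L) :
    -- `f` maps `S` to the base, and its fibers are the curves in question
    (∀ P : ℙ k (Fin 4 → k), HermitianPencil.OnScheme (HermitianPencil.surfaceIdeal k q) P →
      HermitianPencil.pencilMap q L P ∈ HermitianPencil.pencil L) ∧
    (∀ P : ℙ k (Fin 4 → k), ∀ H ∈ HermitianPencil.pencil L,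
      HermitianPencil.OnScheme (HermitianPencil.fiberIdeal q L H) P ↔
        HermitianPencil.OnScheme (HermitianPencil.surfaceIdeal k q) P ∧
          HermitianPencil.pencilMap q L P = H) ∧
    -- the number of singular fibers
    (HermitianPencil.singularFibers q L).ncard = q ^ 2 + 1 ∧
    -- all other fibers
    (∀ H ∈ HermitianPencil.pencil L, H ∉ HermitianPencil.singularFibers q L →
      HermitianPencil.IsRationalCurve (HermitianPencil.fiberIdeal q L H) ∧
      (q ≠ 2 → ∃! P : ℙ k (Fin 4 → k),
        HermitianPencil.IsSingularPoint (HermitianPencil.fiberIdeal q L H) P) ∧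
      (q = 2 → ∀ P : ℙ k (Fin 4 → k),
        ¬ HermitianPencil.IsSingularPoint (HermitianPencil.fiberIdeal q L H) P)) ∧
    -- the singular fibers
    (∀ H ∈ HermitianPencil.singularFibers q L,
      ∃ (lines : Finset (Submodule k (Fin 4 → k))) (P : ℙ k (Fin 4 → k)),
        lines.card = q ∧
        (∀ M ∈ lines, HermitianPencil.IsLineOnSurface q M ∧ P.submodule ≤ M) ∧
        HermitianPencil.fiberIdeal q L H = ⨅ M ∈ lines, HermitianPencil.linearIdeal M ∧
        (∀ M ∈ lines, ∀ N ∈ lines, M ≠ N → HermitianPencil.MeetTransverselyAt q M N P)) := by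
  have hFrob : HermitianPencil.IsFrobeniusPower k q :=
    hq ▸ HermitianPencil.isFrobeniusPower_pow k p a ha
  refine ⟨fun P _ => HermitianPencil.pencilMap_mem_pencil hFrob hL P,
    fun P H hH => HermitianPencil.onScheme_fiberIdeal_iff hFrob hL hH P,
    HermitianPencil.ncard_singularFibers hFrob hL, fun H hH hreg => ?_, fun H hsing => ?_⟩
  · obtain ⟨E⟩ := HermitianPencil.exists_planeCoordinates_of_mem_pencil hFrob hL hH
    rw [E.mem_singularFibers_iff hFrob hL hH] at hreg
    obtain ⟨E', hE'⟩ := E.exists_equation_eq hFrob hL hH hreg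
    have hfib : HermitianPencil.fiberIdeal q L H =
        (Ideal.span {HermitianPencil.cuspidalEquation k q}).comap
          (HermitianPencil.subst E'.toMap) := by
      rw [E'.fiberIdeal_eq hFrob hL, hE', HermitianPencil.cuspidalEquation]
    rw [hfib]
    refine ⟨HermitianPencil.isRationalCurve_comap_cuspidalEquation E'.injective hFrob.ne_zero,
      HermitianPencil.existsUnique_isSingularPoint_cuspidal E'.injective hFrob, fun h2 P hP => ?_⟩
    exact ((HermitianPencil.isSingularPoint_cuspidal_iff E'.injective hFrob P).mp hP).1 h2
  · obtain ⟨E⟩ := HermitianPencil.exists_planeCoordinates_of_mem_pencil hFrob hL hsing.1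
    exact E.exists_lines hFrob hL hsing.1 ((E.mem_singularFibers_iff hFrob hL hsing.1).mp hsing)
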